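/- For even $k\ge 2$ let $G_k(q) = -\frac{\mathsf{B}_k}{2k} + \sum_{n\ge 1}\sum_{d\mid n} d^{k-1}q^n \in \mathbb{C}[[q]]$, where $\mathsf{B}_k$ are the Bernoulli numbers, and let $G_k=0$ for $k$ odd. A series $f\in\mathbb{C}[[q]]$ is a quasimodular form of weight $w$ if it is the $q$-expansion of a weighted homogeneous polynomial of weight $w$ in the free polynomial algebra $\mathbb{C}[G_2,G_4,G_6]$, where $G_i$ has weight $i$; $\frac{d}{dG_2}$ denotes the formal derivative on this algebra. Let $$\wp(z)=\frac{1}{z^2}+2\sum_{k\ge 4}G_k(q)\frac{z^{k-2}}{(k-2)!},$$ a Laurent series in $z$ with coefficients in $\mathbb{C}[[q]]$, let $(\wp-4G_2)^{1/2}=z^{-1}+\dots$ be the formal square root of $\wp(z)-4G_2$ with leading term $z^{-1}$, and put $(\wp-4G_2)^{m+1/2}=(\wp-4G_2)^m(\wp-4G_2)^{1/2}$ for integers $m\ge 0$. With $\mathrm{Res}_{z=0}$ the coefficient of $z^{-1}$, define for $k\ge 0$ $$A_k=\frac{(-1)^k}{(2k+1)!!}\mathrm{Res}_{z=0}\left[(\wp-4G_2)^{k+\frac12}\right],\qquad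 B_k=\frac{(-1)^k}{(2k+3)!!}\mathrm{Res}_{z=0}\left[(\wp-4G_2)^{k+\frac32}(\wp+2G_2)\right].$$ **Proposition.** The sequence $(B_k)_{k\ge 0}$ satisfies the following three conditions, and it is the unique sequence of power series in $\mathbb{C}[[q]]$ that does: (a) For every $k\ge 0$, $B_k$ is a quasimodular form of weight $2k+4$ with $\frac{d}{dG_2}B_k=2B_{k-1}-2A_{k+1}$, where $B_{-1}:=0$. (b) For every $n\ge 0$ there is a polynomial $q_n\in\mathbb{C}[x]$, of degree exactly $2n-2$ if $n\ge 1$ and equal to $0$ if $n=0$, such that for every $k\ge 0$ with $k\ge n-1$ the coefficient of $q^n$ in $B_k$ equals $$\frac{k!}{(2k+1)!\,(-2)^k}\,q_n(k).$$ (c) $B_0=q+O(q^2)$. -/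

import Mathlib

open scoped PowerSeries LaurentSeries

noncomputable section

namespace K3Descendents

/-- The ring of power series in `q` with complex coefficients; `PowerSeries.X` is `q`. -/
abbrev QSeries : Type := ℂ⟦X⟧

/-- The Eisenstein series `G_k = - B_k / (2 k) + ∑_{n ≥ 1} ∑_{d ∣ n} d ^ (k - 1) q ^ n` for even
`k ≥ 2` (with `B_k` the Bernoulli numbers), and `G_k = 0` for odd `k`. -/
def G (k : ℕ) : QSeries :=
  if Even k then
    PowerSeries.mk fun n =>
      if n = 0 then -(bernoulli k : ℂ) / (2 * (k : ℂ)) else ∑ d ∈ n.divisors, (d : ℂ) ^ (k - 1)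
  else 0

/-! ### Quasimodular forms -/

/-- The free polynomial algebra `ℂ[G₂, G₄, G₆]`; the variables `0, 1, 2` stand for
`G₂, G₄, G₆`. -/
abbrev QMod : Type := MvPolynomial (Fin 3) ℂ

/-- The weights `2, 4, 6` of the generators. -/
def genWeight : Fin 3 → ℕ := ![2, 4, 6]

/-- The `q`-expansion of an element of `ℂ[G₂, G₄, G₆]`. -/
def qExp : QMod →ₐ[ℂ] QSeries := MvPolynomial.aeval ![G 2, G 4, G 6]

/-- `f` is (the `q`-expansion of) a quasimodular form of weight `w`. -/
def IsQuasimodular (w : ℕ) (f : QSeries) : Prop :=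
  ∃ P : QMod, MvPolynomial.IsWeightedHomogeneous genWeight P w ∧ qExp P = f

/-- `f` is quasimodular and `d f / d G₂ = g`, where `d / d G₂` is the formal derivative on
`ℂ[G₂, G₄, G₆]`: however `f` is written as a polynomial in `G₂, G₄, G₆`, the `G₂`-derivative of
that polynomial is `g`. -/
def HasG2Derivative (f g : QSeries) : Prop :=
  (∃ P : QMod, qExp P = f) ∧ ∀ P : QMod, qExp P = f → qExp (MvPolynomial.pderiv 0 P) = g

/-! ### The Weierstrass function and its formal square root

Laurent series in `z` whose coefficients are power series in `q`. -/

/-- Laurent series in `z` with coefficients in power series in `q`. -/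
abbrev ZLaurent : Type := LaurentSeries QSeries

/-- The regular part of the Weierstrass function,
`2 ∑_{k ≥ 4} G_k z ^ (k - 2) / (k - 2)!`, indexed by `m = k - 2`. -/
def wpRegular : PowerSeries QSeries :=
  PowerSeries.mk fun m => if 2 ≤ m then (2 / (m.factorial : ℂ)) • G (m + 2) else 0

/-- A power series in `z`, as a Laurent series. -/
def ofZ : PowerSeries QSeries →+* ZLaurent := HahnSeries.ofPowerSeries ℤ QSeries

/-- A power series in `q`, as a Laurent series in `z` that is constant in `z`. -/
def constZ : QSeries →+* ZLaurent := HahnSeries.C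

/-- The monomial `z ^ m`. -/
def zPow (m : ℤ) : ZLaurent := HahnSeries.single m (1 : QSeries)

/-- `℘ = z ^ (-2) + 2 ∑_{k ≥ 4} G_k z ^ (k - 2) / (k - 2)!`. -/
def wp : ZLaurent := zPow (-2) + ofZ wpRegular

/-- `℘ - 4 G₂`. -/
def wpShift : ZLaurent := wp - 4 * constZ (G 2)

/-- The power series `u` in `z` with `℘ - 4 G₂ = z ^ (-2) * (1 + u)`; it has no constant term. -/
def sqrtArg : PowerSeries QSeries := PowerSeries.X ^ 2 * (wpRegular - PowerSeries.C (4 * G 2))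

/-- The formal square root `(℘ - 4 G₂) ^ (1/2) = z ^ (-1) * (1 + u) ^ (1/2)`, with
`(1 + u) ^ (1/2)` expanded by the binomial series. -/
def sqrtWpShift : ZLaurent :=
  zPow (-1) *
    ofZ (PowerSeries.subst sqrtArg (PowerSeries.binomialSeries QSeries (1 / 2 : ℚ)))

theorem wpShift_eq : wpShift = zPow (-2) * ofZ (1 + sqrtArg) := by
  have hX : ofZ (PowerSeries.X ^ 2) = zPow 2 := by
    simp only [ofZ, zPow, HahnSeries.ofPowerSeries_X_pow]
    norm_num
  have hC : ∀ a : QSeries, ofZ (PowerSeries.C a) = constZ a := by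
    intro a
    simp [ofZ, constZ]
  have hz : zPow (-2) * zPow 2 = 1 := by
    simp [zPow, HahnSeries.single_mul_single]
  rw [sqrtArg, map_add, map_mul, map_one, mul_add, mul_one, hX, ← mul_assoc, hz, one_mul,
    map_sub, hC, wpShift, wp, map_mul constZ, map_ofNat constZ 4]
  ring

/-- The formal square root is indeed a square root. -/
theorem sqrtWpShift_sq : sqrtWpShift ^ 2 = wpShift := by
  have hs : PowerSeries.HasSubst sqrtArg :=
    PowerSeries.HasSubst.of_constantCoeff_zero' (by simp [sqrtArg])
  have hb : PowerSeries.binomialSeries QSeries (1 / 2 : ℚ) ^ 2 = 1 + PowerSeries.X := by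
    rw [pow_two, ← PowerSeries.binomialSeries_add]
    have := PowerSeries.binomialSeries_nat (R := ℚ) (A := QSeries) 1
    norm_num at this ⊢
    exact this
  have h1 : PowerSeries.subst sqrtArg (1 + PowerSeries.X : PowerSeries QSeries) = 1 + sqrtArg := by
    rw [← PowerSeries.coe_substAlgHom hs, map_add, map_one, PowerSeries.coe_substAlgHom,
      PowerSeries.subst_X hs]
  have hz : zPow (-1) ^ 2 = zPow (-2) := by
    simp [zPow, HahnSeries.single_pow]
  rw [wpShift_eq, sqrtWpShift, mul_pow, hz, ← map_pow, ← PowerSeries.subst_pow hs, hb, h1]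

/-- The residue at `z = 0`: the coefficient of `z ^ (-1)`. -/
def res (F : ZLaurent) : QSeries := HahnSeries.coeff F (-1)

/-- `A_k = (-1) ^ k / (2 k + 1)!! * Res_{z = 0} (℘ - 4 G₂) ^ (k + 1/2)`. -/
def A (k : ℕ) : QSeries :=
  ((-1 : ℂ) ^ k / ((2 * k + 1).doubleFactorial : ℂ)) • res (wpShift ^ k * sqrtWpShift)

/-- `B_k = (-1) ^ k / (2 k + 3)!! * Res_{z = 0} (℘ - 4 G₂) ^ (k + 3/2) (℘ + 2 G₂)`. -/
def B (k : ℕ) : QSeries :=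
  ((-1 : ℂ) ^ k / ((2 * k + 3).doubleFactorial : ℂ)) •
    res (wpShift ^ (k + 1) * sqrtWpShift * (wp + 2 * constZ (G 2)))

/-! ### The characterizing conditions -/

/-- `S_{k - 1}`, with the convention `S_{-1} = 0`. -/
def prev (S : ℕ → QSeries) : ℕ → QSeries
  | 0 => 0
  | k + 1 => S k

/-- The conditions (a), (b), (c) on a sequence `S` of power series in `q`. In (b) the degree
`2 n - 2` is the exact degree for `n ≥ 1`, and the polynomial is zero for `n = 0`. -/
structure IsCharacterized (S : ℕ → QSeries) : Prop where
  quasimodular : ∀ k : ℕ, IsQuasimodular (2 * k + 4) (S k)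
  derivative : ∀ k : ℕ, HasG2Derivative (S k) (2 * prev S k - 2 * A (k + 1))
  polynomial : ∀ n : ℕ, ∃ Q : Polynomial ℂ,
    (n = 0 → Q = 0) ∧ (1 ≤ n → Q.degree = ((2 * n - 2 : ℕ) : WithBot ℕ)) ∧
    ∀ k : ℕ, n ≤ k + 1 →
      PowerSeries.coeff n (S k) =
        (k.factorial : ℂ) / (((2 * k + 1).factorial : ℂ) * (-2 : ℂ) ^ k) * Q.eval (k : ℂ)
  initial : PowerSeries.X ^ 2 ∣ S 0 - PowerSeries.X

end K3Descendents

end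

/-!
The two halves of the statement, that `B` satisfies the conditions and that nothing else does, rest
on the same fact about `G₂`, on one residue computation, and on one count of zeros.

*The formal derivative.* A polynomial relation between the series `G₂, G₄, G₆` stays true when `G₂`
is replaced by a free variable (`polyG2_eq_zero`): apply matrices of `SL₂(ℤ)` to the relation at a
point `τ` and compare the inhomogeneous transformation law of `E₂` with that of `E₄` and `E₆`.
Hence `d / d G₂` is well defined on `q`-expansions (`qExp_pderiv_eq_zero`), and a quasimodular form
with zero derivative is a modular form (`qExp_eq_aeval_zero`, `aeval_zero_mem_levelOneSeries`).

*Condition (a).* Every `G_k` with `k ≥ 3` is a polynomial in `G₄` and `G₆`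
(`qExpansion_mem_modularPolySeries`), so `℘` lifts to a series in `z` over `ℂ[G₂, G₄, G₆]` with
coefficients free of `G₂`. It is homogeneous, which gives the weight of `B_k`, and differentiating
the lift of `(℘ - 4 G₂) ^ (k + 3/2) (℘ + 2 G₂)` gives `2 B_{k-1} - 2 A_{k+1}`; for `k = 0` the
residue of `(℘ - 4 G₂) ^ (1/2) (℘ + 2 G₂)` has to vanish, which is a direct computation.

*Conditions (b) and (c).* Put `y = coth (z / 2) / 2` and `v = 4 sinh ^ 2 (z / 2)`. At `q = 0` the
series `(℘ - 4 G₂) ^ (1/2)` is `y` and `℘ + 2 G₂` is `1 / v = y ^ 2 - 1 / 4`; the higher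
coefficients in `q` of `℘ - 4 G₂` and `℘ + 2 G₂` are polynomials in `v` (`swapVars_sqrtArg`,
`swapVars_wpPlus`). The binomial expansion around `q = 0` writes the coefficient of `q ^ n` in
`B_k` as a sum of residues of `y ^ (2 N + 1) f(v) dz` with `N = k + 1 - j`, `0 ≤ j ≤ n`. Since
`y ^ 2 = 1 / 4 + 1 / v`, the residue of `y ^ (2 N + 1) v ^ i dz` satisfies the recursion of Pascal's
triangle and equals `4 ^ (i - N)` times the binomial coefficient of `N` and `i`: a polynomial in
`k` up to a power of `4`. The terms with `j ≥ 1` carry the factor `2 k + 3` of `(2 k + 3)!!` in the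
binomial coefficient; integration by parts exhibits it in the term `j = 0`. This gives the
polynomial `coeffPoly n` (`coeff_B`); its degree is read off the two summands of highest degree,
whose leading coefficients are positive and do not cancel
(`natDegree_coeffPoly_le_and_coeff_ne_zero`).

*Uniqueness.* If two sequences satisfy the conditions and agree before `k`, their difference at `k`
is a modular form of weight `2 k + 4`. The polynomials that belong to `q ^ n` differ by a
polynomial of degree at most `2 n - 2` with the zeros `n - 1, …, k - 1`, so they agree if
`3 n ≤ k + 2`. Hence the modular form vanishes to order greater than `(2 k + 4) / 12`, and it is zero by the
Sturm bound.
-/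

noncomputable section

namespace K3Descendents

/-! ### Residues as coefficients of power series -/

/-- The power series `(1 + u) ^ (1/2)` in `z`, where `℘ - 4 G₂ = z ^ (-2) * (1 + u)`. -/
def sqrtSeries : PowerSeries QSeries :=
  PowerSeries.subst sqrtArg (PowerSeries.binomialSeries QSeries (1 / 2 : ℚ))

/-- The power series `z ^ 2 * (℘ + 2 G₂)`. -/
def wpPlus : PowerSeries QSeries := 1 + PowerSeries.X ^ 2 * (wpRegular + PowerSeries.C (2 * G 2))

theorem coeff_subst_of_constantCoeff_zero {R : Type*} [CommRing R] {u : PowerSeries R}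
    (hu : PowerSeries.constantCoeff u = 0) (f : PowerSeries R) {n N : ℕ} (hn : n < N) :
    PowerSeries.coeff n (PowerSeries.subst u f) =
      ∑ j ∈ Finset.range N, PowerSeries.coeff j f * PowerSeries.coeff n (u ^ j) := by
  rw [PowerSeries.coeff_subst' (PowerSeries.HasSubst.of_constantCoeff_zero' hu),
    finsum_eq_sum_of_support_subset (s := Finset.range N)]
  · simp
  · intro j hj
    by_contra hj'
    refine hj ?_
    have hlt : n < j := lt_of_lt_of_le hn (by simpa using hj')
    beta_reduce
    rw [PowerSeries.coeff_of_lt_order (φ := u ^ j), smul_zero]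
    refine lt_of_lt_of_le (by exact_mod_cast hlt)
      (PowerSeries.le_order_pow_of_constantCoeff_eq_zero j hu)

section Binomial

variable {R : Type*} [CommRing R] [Algebra ℚ R]

theorem binomialSeries_half_pow (n : ℕ) :
    PowerSeries.binomialSeries R (1 / 2 : ℚ) ^ n =
      PowerSeries.binomialSeries R ((n : ℚ) / 2) := by
  induction n with
  | zero => simp
  | succ n ih =>
    rw [pow_succ, ih, ← PowerSeries.binomialSeries_add]
    congr 1
    push_cast
    ring

theorem subst_binomialSeries_half_sq {u : PowerSeries R} (hu : PowerSeries.constantCoeff u = 0) :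
    PowerSeries.subst u (PowerSeries.binomialSeries R (1 / 2 : ℚ)) ^ 2 = 1 + u := by
  have hs : PowerSeries.HasSubst u := PowerSeries.HasSubst.of_constantCoeff_zero' hu
  have hb : PowerSeries.binomialSeries R (1 / 2 : ℚ) ^ 2 = 1 + PowerSeries.X := by
    have := PowerSeries.binomialSeries_nat (R := ℚ) (A := R) 1
    rw [binomialSeries_half_pow]
    norm_num at this ⊢
    exact this
  rw [← PowerSeries.subst_pow hs, hb, ← PowerSeries.coe_substAlgHom hs, map_add, map_one,
    PowerSeries.coe_substAlgHom, PowerSeries.subst_X hs]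

theorem constantCoeff_subst_binomialSeries {u : PowerSeries R}
    (hu : PowerSeries.constantCoeff u = 0) (r : ℚ) :
    PowerSeries.constantCoeff (PowerSeries.subst u (PowerSeries.binomialSeries R r)) = 1 := by
  rw [← PowerSeries.coeff_zero_eq_constantCoeff_apply,
    coeff_subst_of_constantCoeff_zero hu _ one_pos]
  simp

end Binomial

theorem eq_of_sq_eq_sq_of_constantCoeff {R : Type*} [CommRing R] [IsDomain R] {a b : PowerSeries R}
    (h : a ^ 2 = b ^ 2) (hab : PowerSeries.constantCoeff a + PowerSeries.constantCoeff b ≠ 0) :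
    a = b := by
  rcases sq_eq_sq_iff_eq_or_eq_neg.mp h with h | h
  · exact h
  · exfalso
    apply hab
    simp [h]

theorem constantCoeff_sqrtArg : PowerSeries.constantCoeff sqrtArg = 0 := by simp [sqrtArg]

theorem sqrtSeries_sq : sqrtSeries ^ 2 = 1 + sqrtArg :=
  subst_binomialSeries_half_sq constantCoeff_sqrtArg

theorem constantCoeff_sqrtSeries : PowerSeries.constantCoeff sqrtSeries = 1 :=
  constantCoeff_subst_binomialSeries constantCoeff_sqrtArg _

theorem zPow_mul_zPow (a b : ℤ) : zPow a * zPow b = zPow (a + b) := by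
  simp [zPow, HahnSeries.single_mul_single]

theorem zPow_pow (a : ℤ) (n : ℕ) : zPow a ^ n = zPow (n * a) := by
  simp [zPow, HahnSeries.single_pow]

theorem res_zPow_mul_ofZ (n : ℕ) (F : PowerSeries QSeries) :
    res (zPow (-(n + 1)) * ofZ F) = PowerSeries.coeff n F := by
  have := HahnSeries.coeff_single_mul_add (r := (1 : QSeries)) (x := ofZ F) (a := (n : ℤ))
    (b := -((n : ℤ) + 1))
  rw [one_mul] at this
  rw [res, zPow, ← HahnSeries.ofPowerSeries_apply_coeff (Γ := ℤ)]
  rwa [show (n : ℤ) + -(n + 1) = -1 by ring] at this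

theorem A_eq_coeff (k : ℕ) :
    A k = ((-1 : ℂ) ^ k / ((2 * k + 1).doubleFactorial : ℂ)) •
      PowerSeries.coeff (2 * k) (sqrtSeries ^ (2 * k + 1)) := by
  have h : wpShift ^ k * sqrtWpShift =
      zPow (-((2 * k : ℕ) + 1)) * ofZ (sqrtSeries ^ (2 * k + 1)) := by
    have h1 : zPow (-((2 * k : ℕ) + 1)) = zPow (-2) ^ k * zPow (-1) := by
      rw [zPow_pow, zPow_mul_zPow]
      congr 1
      push_cast
      ring
    rw [wpShift_eq, sqrtWpShift, ← sqrtSeries, ← sqrtSeries_sq, h1, mul_pow, ← map_pow, ← pow_mul,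
      pow_succ sqrtSeries, map_mul]
    ring
  rw [A, h, res_zPow_mul_ofZ]

theorem B_eq_coeff (k : ℕ) :
    B k = ((-1 : ℂ) ^ k / ((2 * k + 3).doubleFactorial : ℂ)) •
      PowerSeries.coeff (2 * k + 4) (sqrtSeries ^ (2 * k + 3) * wpPlus) := by
  have h2 : wp + 2 * constZ (G 2) = zPow (-2) * ofZ wpPlus := by
    have hX : ofZ (PowerSeries.X ^ 2) = zPow 2 := by
      simp only [ofZ, zPow, HahnSeries.ofPowerSeries_X_pow]
      norm_num
    have hC : ∀ a : QSeries, ofZ (PowerSeries.C a) = constZ a := by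
      intro a
      simp [ofZ, constZ]
    have hz : zPow (-2) * zPow 2 = 1 := by
      simp [zPow, HahnSeries.single_mul_single]
    rw [wpPlus, map_add, map_mul, map_one, mul_add, mul_one, hX, ← mul_assoc, hz, one_mul,
      map_add, hC, wp, map_mul constZ, map_ofNat constZ 2]
    ring
  have h : wpShift ^ (k + 1) * sqrtWpShift * (wp + 2 * constZ (G 2)) =
      zPow (-((2 * k + 4 : ℕ) + 1)) * ofZ (sqrtSeries ^ (2 * k + 3) * wpPlus) := by
    have h1 : zPow (-((2 * k + 4 : ℕ) + 1)) = zPow (-2) ^ (k + 1) * zPow (-1) * zPow (-2) := by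
      rw [zPow_pow, zPow_mul_zPow, zPow_mul_zPow]
      congr 1
      push_cast
      ring
    rw [h2, wpShift_eq, sqrtWpShift, ← sqrtSeries, ← sqrtSeries_sq, h1, mul_pow, ← map_pow,
      ← pow_mul,
      show 2 * k + 3 = 2 * (k + 1) + 1 by ring, pow_succ sqrtSeries, map_mul, map_mul]
    ring
  rw [B, h, res_zPow_mul_ofZ]

/-! ### Level one modular forms and polynomials in `G₄`, `G₆` -/

section ModularForms

open UpperHalfPlane ModularForm ModularFormClass MatrixGroups EisensteinSeries

theorem bernoulli_four : bernoulli 4 = -1 / 30 := by decide +kernel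

theorem bernoulli_six : bernoulli 6 = 1 / 42 := by decide +kernel

/-- The series `G_k` is a multiple of the `q`-expansion of the normalized Eisenstein series. -/
theorem G_eq_smul_qExpansion {k : ℕ} (hk : 3 ≤ k) (hk2 : Even k) (hB : bernoulli k ≠ 0) :
    G k = (-(bernoulli k : ℂ) / (2 * (k : ℂ))) • qExpansion 1 (E hk) := by
  have hB' : (bernoulli k : ℂ) ≠ 0 := by exact_mod_cast hB
  have hk0 : (k : ℂ) ≠ 0 := by exact_mod_cast (by omega : k ≠ 0)
  ext n
  rw [PowerSeries.coeff_smul, E_qExpansion_coeff hk hk2, G, if_pos hk2, PowerSeries.coeff_mk]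
  split_ifs with h
  · simp
  · rw [ArithmeticFunction.sigma_apply]
    push_cast
    rw [smul_eq_mul]
    field_simp

theorem bernoulli_ne_zero_of_even {k : ℕ} (hk : 3 ≤ k) (hk2 : Even k) : bernoulli k ≠ 0 := by
  intro h
  obtain ⟨m, hm⟩ := hk2
  have hm0 : m ≠ 0 := by omega
  have h1 := riemannZeta_two_mul_nat hm0
  rw [show 2 * m = k by omega, h] at h1
  have h2 : riemannZeta (2 * (m : ℂ)) ≠ 0 := by
    apply riemannZeta_ne_zero_of_one_lt_re
    norm_cast
    omega
  apply h2
  rw [h1]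
  simp

/-- The `q`-expansions of level one modular forms of weight `w`. -/
def levelOneSeries (w : ℕ) : Submodule ℂ QSeries where
  carrier := {f | ∃ F : ModularForm 𝒮ℒ (w : ℤ), qExpansion 1 F = f}
  zero_mem' := ⟨0, qExpansion_zero 1⟩
  add_mem' := by
    rintro _ _ ⟨F, rfl⟩ ⟨F', rfl⟩
    exact ⟨F + F', ModularForm.qExpansion_add one_pos one_mem_strictPeriods_SL F F'⟩
  smul_mem' := by
    rintro c _ ⟨F, rfl⟩
    exact ⟨c • F, ModularForm.qExpansion_smul one_pos one_mem_strictPeriods_SL c F⟩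

theorem mul_mem_levelOneSeries {v w : ℕ} {f g : QSeries} (hf : f ∈ levelOneSeries v)
    (hg : g ∈ levelOneSeries w) : f * g ∈ levelOneSeries (v + w) := by
  obtain ⟨F, rfl⟩ := hf
  obtain ⟨F', rfl⟩ := hg
  exact ⟨ModularForm.mcast (by push_cast; ring) (F.mul F'),
    ModularForm.qExpansion_mul one_pos one_mem_strictPeriods_SL F F'⟩

theorem pow_mem_levelOneSeries {w : ℕ} {f : QSeries} (hf : f ∈ levelOneSeries w) (n : ℕ) :
    f ^ n ∈ levelOneSeries (n * w) := by
  obtain ⟨F, rfl⟩ := hf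
  exact ⟨ModularForm.mcast (by push_cast; ring) (F.pow n),
    ModularForm.qExpansion_pow one_pos one_mem_strictPeriods_SL F n⟩

theorem G_mem_levelOneSeries {k : ℕ} (hk : 3 ≤ k) (hk2 : Even k) : G k ∈ levelOneSeries k := by
  rw [G_eq_smul_qExpansion hk hk2 (bernoulli_ne_zero_of_even hk hk2)]
  exact Submodule.smul_mem _ _ ⟨E hk, rfl⟩

/-- Setting `G₂ = 0` in a quasimodular polynomial gives a modular form. -/
theorem aeval_zero_mem_levelOneSeries {P : QMod} {w : ℕ}
    (hP : MvPolynomial.IsWeightedHomogeneous genWeight P w) :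
    MvPolynomial.aeval ![(0 : QSeries), G 4, G 6] P ∈ levelOneSeries w := by
  rw [P.as_sum, map_sum]
  refine Submodule.sum_mem _ fun d hd => ?_
  have hw := hP (MvPolynomial.mem_support_iff.mp hd)
  rw [MvPolynomial.aeval_monomial, ← Algebra.smul_def]
  refine Submodule.smul_mem _ _ ?_
  rw [Finsupp.weight_apply, Finsupp.sum_fintype _ _ (by simp), Fin.sum_univ_three] at hw
  rw [Finsupp.prod_fintype _ _ (by simp), Fin.prod_univ_three]
  simp only [genWeight, smul_eq_mul, Matrix.cons_val_zero, Matrix.cons_val_one,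
    Matrix.cons_val] at hw ⊢
  by_cases h0 : d 0 = 0
  · rw [h0, pow_zero, one_mul, show w = d 1 * 4 + d 2 * 6 by omega]
    exact mul_mem_levelOneSeries
      (pow_mem_levelOneSeries (G_mem_levelOneSeries (by norm_num) (by decide)) _)
      (pow_mem_levelOneSeries (G_mem_levelOneSeries (by norm_num) (by decide)) _)
  · rw [zero_pow h0, zero_mul, zero_mul]
    exact Submodule.zero_mem _

/-- The `q`-expansions of the quasimodular polynomials of weight `w` in which `G₂` does not
occur. -/
def modularPolySeries (w : ℕ) : Submodule ℂ QSeries where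
  carrier := {f | ∃ P : QMod, MvPolynomial.IsWeightedHomogeneous genWeight P w ∧
    MvPolynomial.pderiv 0 P = 0 ∧ qExp P = f}
  zero_mem' := ⟨0, MvPolynomial.isWeightedHomogeneous_zero _ _ _, map_zero _, map_zero _⟩
  add_mem' := by
    rintro _ _ ⟨P, h1, h2, rfl⟩ ⟨P', h1', h2', rfl⟩
    exact ⟨P + P', h1.add h1', by rw [map_add, h2, h2', add_zero], map_add _ _ _⟩
  smul_mem' := by
    rintro c _ ⟨P, h1, h2, rfl⟩
    exact ⟨c • P, (MvPolynomial.weightedHomogeneousSubmodule ℂ genWeight w).smul_mem c h1,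
      by rw [Derivation.map_smul, h2, smul_zero], map_smul _ _ _⟩

theorem mul_mem_modularPolySeries {v w : ℕ} {f g : QSeries} (hf : f ∈ modularPolySeries v)
    (hg : g ∈ modularPolySeries w) : f * g ∈ modularPolySeries (v + w) := by
  obtain ⟨P, h1, h2, rfl⟩ := hf
  obtain ⟨P', h1', h2', rfl⟩ := hg
  exact ⟨P * P', h1.mul h1', by rw [Derivation.leibniz, h2, h2', smul_zero, smul_zero, add_zero],
    map_mul _ _ _⟩

theorem one_mem_modularPolySeries : (1 : QSeries) ∈ modularPolySeries 0 :=
  ⟨1, MvPolynomial.isWeightedHomogeneous_one _ _, Derivation.map_one_eq_zero _, map_one _⟩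

theorem pow_mem_modularPolySeries {w : ℕ} {f : QSeries} (hf : f ∈ modularPolySeries w) (n : ℕ) :
    f ^ n ∈ modularPolySeries (n * w) := by
  induction n with
  | zero => simpa using one_mem_modularPolySeries
  | succ n ih =>
    rw [pow_succ, Nat.succ_mul]
    exact mul_mem_modularPolySeries ih hf

theorem G_four_mem_modularPolySeries : G 4 ∈ modularPolySeries 4 :=
  ⟨MvPolynomial.X 1, MvPolynomial.isWeightedHomogeneous_X _ _ _,
    MvPolynomial.pderiv_X_of_ne (by decide), by simp [qExp]⟩

theorem G_six_mem_modularPolySeries : G 6 ∈ modularPolySeries 6 :=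
  ⟨MvPolynomial.X 2, MvPolynomial.isWeightedHomogeneous_X _ _ _,
    MvPolynomial.pderiv_X_of_ne (by decide), by simp [qExp]⟩

theorem qExpansion_E_four_mem :
    qExpansion 1 (E (k := 4) (by norm_num)) ∈ modularPolySeries 4 := by
  have h := G_eq_smul_qExpansion (k := 4) (by norm_num) (by decide) (by norm_num [bernoulli_four])
  have h' : qExpansion 1 (E (k := 4) (by norm_num)) = (240 : ℂ) • G 4 := by
    rw [h, smul_smul, bernoulli_four]
    norm_num
  rw [h']
  exact Submodule.smul_mem _ _ G_four_mem_modularPolySeries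

theorem qExpansion_E_six_mem :
    qExpansion 1 (E (k := 6) (by norm_num)) ∈ modularPolySeries 6 := by
  have h := G_eq_smul_qExpansion (k := 6) (by norm_num) (by decide) (by norm_num [bernoulli_six])
  have h' : qExpansion 1 (E (k := 6) (by norm_num)) = (-504 : ℂ) • G 6 := by
    rw [h, smul_smul, bernoulli_six]
    norm_num
  rw [h']
  exact Submodule.smul_mem _ _ G_six_mem_modularPolySeries

theorem qExpansion_discriminant_mem :
    qExpansion 1 ModularForm.discriminant ∈ modularPolySeries 12 := by
  set E4 : ModularForm 𝒮ℒ 4 := E (k := 4) (by norm_num)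
  set E6 : ModularForm 𝒮ℒ 6 := E (k := 6) (by norm_num)
  let F : ModularForm 𝒮ℒ 12 :=
    ModularForm.mcast (by decide) (E4.pow 3) - ModularForm.mcast (by decide) (E6.pow 2)
  have hF : qExpansion 1 F = qExpansion 1 E4 ^ 3 - qExpansion 1 E6 ^ 2 := by
    simp only [F, FunLike.coe_sub, ModularForm.coe_mcast,
      ModularForm.qExpansion_sub one_pos one_mem_strictPeriods_SL,
      ModularForm.qExpansion_pow one_pos one_mem_strictPeriods_SL]
  have hD : (ModularForm.discriminant : ℍ → ℂ) = ((1 / 1728 : ℂ) • F : ModularForm 𝒮ℒ 12) := by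
    funext z
    rw [ModularForm.discriminant_eq_E₄_cube_sub_E₆_sq]
    have h4 : (E4.pow 3) z = E4 z ^ 3 := by rw [ModularForm.coe_pow]; rfl
    have h6 : (E6.pow 2) z = E6 z ^ 2 := by rw [ModularForm.coe_pow]; rfl
    simp only [F, FunLike.coe_smul, FunLike.coe_sub, ModularForm.coe_mcast, Pi.smul_apply,
      Pi.sub_apply, h4, h6, E4, E6, smul_eq_mul]
    ring
  rw [hD, FunLike.coe_smul, ModularForm.qExpansion_smul one_pos one_mem_strictPeriods_SL, hF]
  exact Submodule.smul_mem _ _ (Submodule.sub_mem _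
    (pow_mem_modularPolySeries qExpansion_E_four_mem 3)
    (pow_mem_modularPolySeries qExpansion_E_six_mem 2))

/-- Every level one modular form is a polynomial in `G₄` and `G₆`: subtract a multiple of a
monomial in `E₄`, `E₆` to reach a cusp form, and divide it by the discriminant. -/
theorem qExpansion_mem_modularPolySeries (k : ℕ) (F : ModularForm 𝒮ℒ (k : ℤ)) :
    qExpansion 1 F ∈ modularPolySeries k := by
  induction k using Nat.strong_induction_on with
  | _ k ih =>
  by_cases hodd : Odd k
  · rw [ModularForm.levelOne_odd_weight_eq_zero (by exact_mod_cast hodd) F]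
    have : qExpansion 1 (0 : ModularForm 𝒮ℒ (k : ℤ)) = 0 := qExpansion_zero 1
    rw [this]
    exact Submodule.zero_mem _
  have heven : Even k := Nat.not_odd_iff_even.mp hodd
  by_cases h2 : k = 2
  · subst h2
    rw [rank_zero_iff_forall_zero.mp ModularForm.levelOne_weight_two_rank_zero F]
    have : qExpansion 1 (0 : ModularForm 𝒮ℒ ((2 : ℕ) : ℤ)) = 0 := qExpansion_zero 1
    rw [this]
    exact Submodule.zero_mem _
  obtain ⟨a, b, hab⟩ : ∃ a b : ℕ, k = a * 4 + b * 6 := by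
    obtain ⟨m, hm⟩ := heven
    rcases Nat.even_or_odd' m with ⟨c, hc | hc⟩
    · exact ⟨c, 0, by omega⟩
    · exact ⟨c - 1, 1, by omega⟩
  set E4 : ModularForm 𝒮ℒ 4 := E (k := 4) (by norm_num)
  set E6 : ModularForm 𝒮ℒ 6 := E (k := 6) (by norm_num)
  let H : ModularForm 𝒮ℒ (k : ℤ) :=
    ModularForm.mcast (by rw [hab]; push_cast; ring) ((E4.pow a).mul (E6.pow b))
  have hH : qExpansion 1 H = qExpansion 1 E4 ^ a * qExpansion 1 E6 ^ b := by
    rw [← ModularForm.qExpansion_pow one_pos one_mem_strictPeriods_SL,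
      ← ModularForm.qExpansion_pow one_pos one_mem_strictPeriods_SL]
    exact ModularForm.qExpansion_mul one_pos one_mem_strictPeriods_SL _ _
  have hHmem : qExpansion 1 H ∈ modularPolySeries k := by
    rw [hH, hab]
    exact mul_mem_modularPolySeries (pow_mem_modularPolySeries qExpansion_E_four_mem a)
      (pow_mem_modularPolySeries qExpansion_E_six_mem b)
  have hH0 : (qExpansion 1 H).coeff 0 = 1 := by
    have h4 : (qExpansion 1 E4).coeff 0 = 1 := E_qExpansion_coeff_zero (by norm_num) (by decide)
    have h6 : (qExpansion 1 E6).coeff 0 = 1 := E_qExpansion_coeff_zero (by norm_num) (by decide)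
    rw [PowerSeries.coeff_zero_eq_constantCoeff_apply] at h4 h6 ⊢
    rw [hH, map_mul, map_pow, map_pow, h4, h6, one_pow, one_pow, one_mul]
  set c : ℂ := (qExpansion 1 F).coeff 0
  have hsub : qExpansion 1 (F - c • H : ModularForm 𝒮ℒ (k : ℤ)) =
      qExpansion 1 F - c • qExpansion 1 H := by
    rw [FunLike.coe_sub, ModularForm.qExpansion_sub one_pos one_mem_strictPeriods_SL,
      FunLike.coe_smul, ModularForm.qExpansion_smul one_pos one_mem_strictPeriods_SL]
  have hcusp : (qExpansion 1 (F - c • H : ModularForm 𝒮ℒ (k : ℤ))).coeff 0 = 0 := by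
    rw [hsub, map_sub, PowerSeries.coeff_smul, hH0, smul_eq_mul, mul_one, sub_self]
  have hmem : qExpansion 1 (F - c • H : ModularForm 𝒮ℒ (k : ℤ)) ∈ modularPolySeries k := by
    rw [ModularForm.qExpansion_eq_qExpansion_discriminant_mul _ hcusp]
    set F' := CuspForm.discriminantEquiv (ModularForm.toCuspForm _ hcusp)
    rcases lt_or_ge k 12 with hk | hk
    · have : F' = 0 := rank_zero_iff_forall_zero.mp
        (ModularForm.levelOne_neg_weight_rank_zero (by omega)) F'
      rw [this]
      have : qExpansion 1 (0 : ModularForm 𝒮ℒ ((k : ℤ) - 12)) = 0 := qExpansion_zero 1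
      rw [this, mul_zero]
      exact Submodule.zero_mem _
    · have h1 := ih (k - 12) (by omega) (ModularForm.mcast (by push_cast [hk]; ring) F')
      rw [ModularForm.qExpansion_mcast] at h1
      have h2 := mul_mem_modularPolySeries qExpansion_discriminant_mem h1
      rwa [show 12 + (k - 12) = k by omega] at h2
  rw [hsub] at hmem
  have := Submodule.add_mem _ hmem (Submodule.smul_mem _ c hHmem)
  rwa [sub_add_cancel] at this

theorem G_mem_modularPolySeries {k : ℕ} (hk : 3 ≤ k) : G k ∈ modularPolySeries k := by
  by_cases hk2 : Even k
  · obtain ⟨F, hF⟩ := G_mem_levelOneSeries hk hk2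
    rw [← hF]
    exact qExpansion_mem_modularPolySeries k F
  · rw [G, if_neg hk2]
    exact Submodule.zero_mem _

end ModularForms

/-! ### Polynomial relations between `G₂`, `G₄`, `G₆` -/

/-- The series `f` converges at `x`, with value `y`. -/
def HasValue (f : QSeries) (x y : ℂ) : Prop :=
  HasSum (fun n => PowerSeries.coeff n f * x ^ n) y

namespace HasValue

variable {f g : QSeries} {x y z : ℂ}

theorem const (c x : ℂ) : HasValue (PowerSeries.C c) x c := by
  have := hasSum_single (f := fun n => PowerSeries.coeff n (PowerSeries.C c) * x ^ n) 0
    (by intro n hn; simp [PowerSeries.coeff_C, hn])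
  simpa [HasValue] using this

theorem add (hf : HasValue f x y) (hg : HasValue g x z) : HasValue (f + g) x (y + z) := by
  simpa [HasValue, add_mul] using HasSum.add hf hg

theorem sub (hf : HasValue f x y) (hg : HasValue g x z) : HasValue (f - g) x (y - z) := by
  simpa [HasValue, sub_mul] using HasSum.sub hf hg

theorem smul (c : ℂ) (hf : HasValue f x y) : HasValue (c • f) x (c * y) := by
  simpa [HasValue, mul_assoc] using HasSum.mul_left c hf

theorem mul (hf : HasValue f x y) (hg : HasValue g x z) : HasValue (f * g) x (y * z) := by
  have h1 := hf.summable.norm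
  have h2 := hg.summable.norm
  have h3 := tsum_mul_tsum_eq_tsum_sum_antidiagonal_of_summable_norm h1 h2
  have h4 := (summable_norm_sum_mul_antidiagonal_of_summable_norm h1 h2).of_norm
  have h5 := h4.hasSum
  rw [← h3, hf.tsum_eq, hg.tsum_eq] at h5
  refine h5.congr_fun ?_
  intro n
  rw [PowerSeries.coeff_mul, Finset.sum_mul]
  refine Finset.sum_congr rfl fun p hp => ?_
  rw [← Finset.HasAntidiagonal.mem_antidiagonal.mp hp, pow_add]
  ring

theorem aeval {a : Fin 3 → QSeries} {b : Fin 3 → ℂ} (h : ∀ i, HasValue (a i) x (b i))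
    (P : QMod) : HasValue (MvPolynomial.aeval a P) x (MvPolynomial.eval b P) := by
  induction P using MvPolynomial.induction_on with
  | C c =>
    rw [MvPolynomial.aeval_C, MvPolynomial.eval_C]
    exact const c x
  | add P Q hP hQ =>
    rw [map_add, map_add]
    exact hP.add hQ
  | mul_X P i hP =>
    rw [map_mul, map_mul, MvPolynomial.aeval_X, MvPolynomial.eval_X]
    exact hP.mul (h i)

end HasValue

section Transformation

open UpperHalfPlane ModularForm ModularFormClass MatrixGroups EisensteinSeries

/-- The parameter `q = exp (2 π i τ)`. -/
abbrev qVal (τ : ℍ) : ℂ := Function.Periodic.qParam 1 (τ : ℂ)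

/-- A series that vanishes at all `q = exp (2 π i τ)` is zero. -/
theorem eq_zero_of_hasValue_zero {f : QSeries} (hf : ∀ τ : ℍ, HasValue f (qVal τ) 0) : f = 0 := by
  have hfun : ∀ x : ℂ, ‖x‖ < 1 → x ≠ 0 → HasValue f x 0 := by
    intro x hx hx0
    have h1 := Function.Periodic.im_invQParam_pos_of_norm_lt_one one_pos hx hx0
    have h2 := hf ⟨Function.Periodic.invQParam 1 x, h1⟩
    have h3 : qVal ⟨Function.Periodic.invQParam 1 x, h1⟩ = x :=
      Function.Periodic.qParam_right_inv one_ne_zero hx0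
    rwa [h3] at h2
  by_contra hne
  -- Dividing by the lowest power of `q` leaves a series with nonzero constant term, whose sum
  -- is continuous at `0` and vanishes on a punctured disc.
  set p : FormalMultilinearSeries ℂ ℂ ℂ := .ofScalars ℂ (fun n => PowerSeries.coeff n f) with hp
  have hrad : (1 / 2 : NNReal) ≤ p.radius := by
    apply FormalMultilinearSeries.le_radius_of_summable
    have := (hfun (1 / 2) (by norm_num) (by norm_num)).summable.norm
    refine this.congr fun n => ?_
    simp [hp]
  have hpos : 0 < p.radius := lt_of_lt_of_le (by norm_num) hrad
  have hball := p.hasFPowerSeriesOnBall hpos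
  have han : AnalyticAt ℂ p.sum 0 := hball.analyticAt
  have hfreq : ∃ᶠ x in nhdsWithin (0 : ℂ) {0}ᶜ, p.sum x = 0 := by
    apply Filter.Eventually.frequently
    have hb : Metric.ball (0 : ℂ) 1 ∈ nhdsWithin (0 : ℂ) {0}ᶜ :=
      mem_nhdsWithin_of_mem_nhds (Metric.ball_mem_nhds 0 one_pos)
    filter_upwards [hb, self_mem_nhdsWithin] with x hx hx0
    have := hfun x (by simpa using hx) (by simpa using hx0)
    rw [FormalMultilinearSeries.sum, ← this.tsum_eq]
    refine tsum_congr fun n => ?_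
    simp [hp, mul_comm]
  have hz := han.frequently_zero_iff_eventually_zero.mp hfreq
  have := hball.hasFPowerSeriesAt.eq_zero_of_eventually hz
  apply hne
  ext n
  have h : p.coeff n = 0 := by
    rw [this]
    rfl
  simpa [hp, FormalMultilinearSeries.coeff_ofScalars] using h

/-- The values of `G₂`, `G₄`, `G₆` at a point of the upper half plane. -/
def eisVal (τ : ℍ) : Fin 3 → ℂ :=
  ![-(1 / 24) * E2 τ, (1 / 240) * E (k := 4) (by norm_num) τ,
    -(1 / 504) * E (k := 6) (by norm_num) τ]

theorem hasValue_G_of_three_le {k : ℕ} (hk : 3 ≤ k) (hk2 : Even k) (τ : ℍ) :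
    HasValue (G k) (qVal τ) (-(bernoulli k : ℂ) / (2 * (k : ℂ)) * E hk τ) := by
  rw [G_eq_smul_qExpansion hk hk2 (bernoulli_ne_zero_of_even hk hk2)]
  apply HasValue.smul
  have : Fact (IsCusp OnePoint.infty 𝒮ℒ) :=
    ⟨Subgroup.isCusp_of_mem_strictPeriods one_pos one_mem_strictPeriods_SL⟩
  have := hasSum_qExpansion one_pos
    (SlashInvariantFormClass.periodic_comp_ofComplex (E hk) one_mem_strictPeriods_SL)
    (ModularFormClass.holo (E hk)) (ModularFormClass.bdd_at_infty (E hk)) τ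
  simpa [HasValue] using this

theorem hasValue_G_two (τ : ℍ) : HasValue (G 2) (qVal τ) (-(1 / 24) * E2 τ) := by
  have h := (hasSum_qExpansion_E2 τ).mul_left (-(1 / 24) : ℂ)
  refine h.congr_fun ?_
  intro n
  rw [G, if_pos (by decide), PowerSeries.coeff_mk, ArithmeticFunction.sigma_apply]
  split_ifs with hn
  · subst hn
    simp [bernoulli_two]
    norm_num
  · have hq : qVal τ = Complex.exp (2 * Real.pi * Complex.I * τ) := by
      simp [qVal, Function.Periodic.qParam]
    rw [hq]
    push_cast
    simp
    ring

theorem hasValue_G (τ : ℍ) (i : Fin 3) :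
    HasValue ((![G 2, G 4, G 6] : Fin 3 → QSeries) i) (qVal τ) (eisVal τ i) := by
  fin_cases i
  · exact hasValue_G_two τ
  · have := hasValue_G_of_three_le (k := 4) (by norm_num) (by decide) τ
    rw [bernoulli_four] at this
    have h : eisVal τ 1 =
        -((-1 / 30 : ℚ) : ℂ) / (2 * ((4 : ℕ) : ℂ)) * E (k := 4) (by norm_num) τ := by
      change (1 / 240 : ℂ) * E (k := 4) (by norm_num) τ = _
      norm_num
    change HasValue (G 4) (qVal τ) (eisVal τ 1)
    rwa [h]
  · have := hasValue_G_of_three_le (k := 6) (by norm_num) (by decide) τ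
    rw [bernoulli_six] at this
    have h : eisVal τ 2 =
        -((1 / 42 : ℚ) : ℂ) / (2 * ((6 : ℕ) : ℂ)) * E (k := 6) (by norm_num) τ := by
      change -(1 / 504 : ℂ) * E (k := 6) (by norm_num) τ = _
      norm_num
    change HasValue (G 6) (qVal τ) (eisVal τ 2)
    rwa [h]

/-- The element of `SL₂(ℤ)` with rows `(1, m)` and `(c, c m + 1)`. -/
def lowerUpper (c m : ℤ) : SL(2, ℤ) :=
  ⟨!![1, m; c, c * m + 1], by rw [Matrix.det_fin_two_of]; ring⟩

theorem denom_lowerUpper (c m : ℤ) (τ : ℍ) :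
    denom (lowerUpper c m) τ = c * (τ + m) + 1 := by
  rw [ModularGroup.denom_apply]
  simp [lowerUpper]
  ring

theorem E_smul {k : ℕ} (hk : 3 ≤ k) (γ : SL(2, ℤ)) (τ : ℍ) :
    E hk (γ • τ) = denom γ τ ^ k * E hk τ := by
  have h := congrFun ((E hk).slash_action_eq' γ ⟨γ, rfl⟩) τ
  have h' : ((E hk : ℍ → ℂ) ∣[(k : ℤ)] γ) τ = E hk τ := h
  rw [SL_slash_apply] at h'
  have hd := denom_ne_zero γ τ
  rw [← h', zpow_neg, zpow_natCast]
  field_simp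

/-- `E₂` is quasimodular of weight `2`; the constant `κ` is `6 / (π i)`. -/
theorem exists_E2_smul : ∃ κ : ℂ, κ ≠ 0 ∧ ∀ (γ : SL(2, ℤ)) (τ : ℍ),
    E2 (γ • τ) = denom γ τ ^ 2 * E2 τ + κ * (γ 1 0 : ℂ) * denom γ τ := by
  have hζ : riemannZeta 2 ≠ 0 := riemannZeta_ne_zero_of_one_lt_re (by norm_num)
  refine ⟨-(1 / (2 * riemannZeta 2) * (2 * Real.pi * Complex.I)), ?_, fun γ τ => ?_⟩
  · have : (Real.pi : ℂ) ≠ 0 := by exact_mod_cast Real.pi_ne_zero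
    simp [hζ, this]
  · have h := congrFun (E2_slash_action γ) τ
    have hd := denom_ne_zero γ τ
    rw [SL_slash_apply] at h
    simp only [Pi.sub_apply, Pi.smul_apply, D2, smul_eq_mul] at h
    have h2 : denom γ τ ^ (-2 : ℤ) = (denom γ τ ^ 2)⁻¹ := by
      rw [zpow_neg]
      norm_cast
    rw [h2] at h
    have h3 : E2 (γ • τ) = denom γ τ ^ 2 * (E2 (γ • τ) * (denom γ τ ^ 2)⁻¹) := by field_simp
    rw [h3, h]
    field_simp
    ring

/-- The polynomial `P(y, G₄(τ), G₆(τ))` in the variable `y`. -/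
def polyG2 (τ : ℍ) : QMod →ₐ[ℂ] Polynomial ℂ :=
  MvPolynomial.aeval ![Polynomial.X, Polynomial.C (eisVal τ 1), Polynomial.C (eisVal τ 2)]

theorem eval_polyG2 (τ : ℍ) (y : ℂ) (P : QMod) :
    (polyG2 τ P).eval y = MvPolynomial.eval ![y, eisVal τ 1, eisVal τ 2] P := by
  induction P using MvPolynomial.induction_on with
  | C c => simp [polyG2]
  | add P Q hP hQ => rw [map_add, map_add, Polynomial.eval_add, hP, hQ]
  | mul_X P i hP =>
    rw [map_mul, map_mul, Polynomial.eval_mul, hP]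
    fin_cases i <;> simp [polyG2]

theorem derivative_polyG2 (τ : ℍ) (P : QMod) :
    Polynomial.derivative (polyG2 τ P) = polyG2 τ (MvPolynomial.pderiv 0 P) := by
  induction P using MvPolynomial.induction_on with
  | C c => simp [polyG2]
  | add P Q hP hQ => rw [map_add, map_add, hP, hQ, map_add, map_add]
  | mul_X P i hP =>
    rw [map_mul, Polynomial.derivative_mul, hP, Derivation.leibniz]
    fin_cases i <;> simp [polyG2, MvPolynomial.pderiv_X] <;> ring

/-- A polynomial relation between `G₂`, `G₄`, `G₆` remains valid when `G₂` is replaced by a free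
variable: transform the relation at `τ` by all matrices with lower row `(c, c m + 1)`, which for
fixed `c` gives infinitely many values of the automorphy factor, and then vary `c`. -/
theorem polyG2_eq_zero {P : QMod} (hP : qExp P = 0) (τ : ℍ) : polyG2 τ P = 0 := by
  have hval : ∀ τ' : ℍ, MvPolynomial.eval (eisVal τ') P = 0 := by
    intro τ'
    have h1 := HasValue.aeval (hasValue_G τ') P
    have h2 : HasValue (qExp P) (qVal τ') 0 := by
      rw [hP, ← map_zero PowerSeries.C]
      exact HasValue.const 0 _
    exact h1.unique h2
  obtain ⟨κ, hκ, hE2⟩ := exists_E2_smul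
  -- The transformed relation is a polynomial in the automorphy factor; it is evaluated at `1`.
  have hc : ∀ c : ℤ, c ≠ 0 → MvPolynomial.eval
      ![eisVal τ 0 + -(1 / 24) * κ * c, eisVal τ 1, eisVal τ 2] P = 0 := by
    intro c hc
    let R : Polynomial ℂ := MvPolynomial.aeval
      ![Polynomial.C (eisVal τ 0) * Polynomial.X ^ 2 +
          Polynomial.C (-(1 / 24) * κ * c) * Polynomial.X,
        Polynomial.C (eisVal τ 1) * Polynomial.X ^ 4,
        Polynomial.C (eisVal τ 2) * Polynomial.X ^ 6] P
    have hR : ∀ x : ℂ, R.eval x = MvPolynomial.eval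
        ![eisVal τ 0 * x ^ 2 + -(1 / 24) * κ * c * x, eisVal τ 1 * x ^ 4,
          eisVal τ 2 * x ^ 6] P := by
      intro x
      simp only [R]
      generalize P = P'
      induction P' using MvPolynomial.induction_on with
      | C c => simp
      | add P Q hP hQ => rw [map_add, map_add, Polynomial.eval_add, hP, hQ]
      | mul_X P i hP =>
        rw [map_mul (MvPolynomial.aeval _), map_mul (MvPolynomial.eval _), Polynomial.eval_mul, hP]
        congr 1
        fin_cases i <;> simp
    have hroot : ∀ m : ℤ, R.eval (c * ((τ : ℂ) + m) + 1) = 0 := by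
      intro m
      rw [hR, ← hval (lowerUpper c m • τ)]
      congr 2
      have h10 : (lowerUpper c m) 1 0 = c := rfl
      have h0 := hE2 (lowerUpper c m) τ
      have h4 := E_smul (k := 4) (by norm_num) (lowerUpper c m) τ
      have h6 := E_smul (k := 6) (by norm_num) (lowerUpper c m) τ
      rw [denom_lowerUpper] at h0 h4 h6
      rw [h10] at h0
      funext i
      fin_cases i
      · change -(1 / 24) * E2 τ * _ + _ = -(1 / 24) * E2 (lowerUpper c m • τ)
        rw [h0]
        ring
      · change 1 / 240 * E (k := 4) (by norm_num) τ * _ =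
          1 / 240 * E (k := 4) (by norm_num) (lowerUpper c m • τ)
        rw [h4]
        ring
      · change -(1 / 504) * E (k := 6) (by norm_num) τ * _ =
          -(1 / 504) * E (k := 6) (by norm_num) (lowerUpper c m • τ)
        rw [h6]
        ring
    have hR0 : R = 0 := by
      apply Polynomial.eq_zero_of_infinite_isRoot
      refine Set.infinite_of_injective_forall_mem (f := fun m : ℤ => (c : ℂ) * ((τ : ℂ) + m) + 1)
        ?_ hroot
      intro m m' h
      have hc' : (c : ℂ) ≠ 0 := by exact_mod_cast hc
      simpa [hc'] using h
    have := hR 1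
    rw [hR0] at this
    simpa using this.symm
  apply Polynomial.eq_zero_of_infinite_isRoot
  refine Set.infinite_of_injective_forall_mem
    (f := fun n : ℕ => eisVal τ 0 + -(1 / 24) * κ * ((n + 1 : ℤ) : ℂ)) ?_ ?_
  · intro m m' h
    simpa [hκ] using h
  · intro n
    show Polynomial.eval _ _ = 0
    rw [eval_polyG2]
    exact hc _ (by positivity)

/-- The formal `G₂`-derivative descends to `q`-expansions. -/
theorem qExp_pderiv_eq_zero {P : QMod} (hP : qExp P = 0) :
    qExp (MvPolynomial.pderiv 0 P) = 0 := by
  refine eq_zero_of_hasValue_zero fun τ => ?_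
  have h1 := HasValue.aeval (hasValue_G τ) (MvPolynomial.pderiv 0 P)
  have h2 : MvPolynomial.eval (eisVal τ) (MvPolynomial.pderiv 0 P) = 0 := by
    have h := eval_polyG2 τ (eisVal τ 0) (MvPolynomial.pderiv 0 P)
    rw [← derivative_polyG2, polyG2_eq_zero hP, Polynomial.derivative_zero,
      Polynomial.eval_zero] at h
    rw [h]
    congr 2
  rwa [h2] at h1

/-- If the `G₂`-derivative of a quasimodular polynomial has zero `q`-expansion, `G₂` may be set
to zero without changing the `q`-expansion of the polynomial. -/
theorem qExp_eq_aeval_zero {P : QMod} (hP : qExp (MvPolynomial.pderiv 0 P) = 0) :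
    qExp P = MvPolynomial.aeval ![(0 : QSeries), G 4, G 6] P := by
  rw [← sub_eq_zero]
  refine eq_zero_of_hasValue_zero fun τ => ?_
  have h1 := HasValue.aeval (hasValue_G τ) P
  have h2 : HasValue (MvPolynomial.aeval ![(0 : QSeries), G 4, G 6] P) (qVal τ)
      (MvPolynomial.eval ![0, eisVal τ 1, eisVal τ 2] P) := by
    apply HasValue.aeval
    intro i
    fin_cases i
    · simpa using HasValue.const 0 (qVal τ)
    · exact hasValue_G τ 1
    · exact hasValue_G τ 2
  have h3 : MvPolynomial.eval (eisVal τ) P =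
      MvPolynomial.eval ![0, eisVal τ 1, eisVal τ 2] P := by
    have hd : Polynomial.derivative (polyG2 τ P) = 0 := by
      rw [derivative_polyG2, polyG2_eq_zero hP]
    have hC := Polynomial.eq_C_of_derivative_eq_zero hd
    have h4 := eval_polyG2 τ (eisVal τ 0) P
    have h5 := eval_polyG2 τ 0 P
    rw [hC, Polynomial.eval_C] at h4 h5
    rw [← h5, h4]
    congr 2
  have := h1.sub h2
  rwa [h3, sub_self] at this

end Transformation

/-! ### Lifting to the polynomial ring `ℂ[G₂, G₄, G₆]` -/

theorem powerSeries_two_ne_zero {R : Type*} [CommRing R] (h : (2 : R) ≠ 0) :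
    (2 : PowerSeries R) ≠ 0 := by
  intro h'
  apply h
  have := congrArg PowerSeries.constantCoeff h'
  rwa [map_ofNat, map_zero] at this

theorem qSeries_two_ne_zero : (2 : QSeries) ≠ 0 := powerSeries_two_ne_zero two_ne_zero

theorem exists_lift_G (k : ℕ) : ∃ P : QMod, 3 ≤ k →
    MvPolynomial.IsWeightedHomogeneous genWeight P k ∧ MvPolynomial.pderiv 0 P = 0 ∧
      qExp P = G k := by
  by_cases hk : 3 ≤ k
  · obtain ⟨P, hP⟩ := G_mem_modularPolySeries hk
    exact ⟨P, fun _ => hP⟩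
  · exact ⟨0, fun h => absurd h hk⟩

/-- For `k ≥ 3`, a homogeneous polynomial in `G₄` and `G₆` with `q`-expansion `G_k`. -/
def liftG (k : ℕ) : QMod := (exists_lift_G k).choose

theorem liftG_spec {k : ℕ} (hk : 3 ≤ k) :
    MvPolynomial.IsWeightedHomogeneous genWeight (liftG k) k ∧
      MvPolynomial.pderiv 0 (liftG k) = 0 ∧ qExp (liftG k) = G k :=
  (exists_lift_G k).choose_spec hk

/-- The regular part of the Weierstrass function, with coefficients in `ℂ[G₂, G₄, G₆]`. -/
def liftRegular : PowerSeries QMod :=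
  PowerSeries.mk fun m => if 2 ≤ m then (2 / (m.factorial : ℂ)) • liftG (m + 2) else 0

/-- The series `z ^ 2 * (℘ - 4 G₂) - 1`, with coefficients in `ℂ[G₂, G₄, G₆]`. -/
def liftSqrtArg : PowerSeries QMod :=
  PowerSeries.X ^ 2 * (liftRegular - PowerSeries.C (4 * MvPolynomial.X 0))

/-- The series `z ^ 2 * (℘ + 2 G₂)`, with coefficients in `ℂ[G₂, G₄, G₆]`. -/
def liftWpPlus : PowerSeries QMod :=
  1 + PowerSeries.X ^ 2 * (liftRegular + PowerSeries.C (2 * MvPolynomial.X 0))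

/-- The series `z * (℘ - 4 G₂) ^ (1/2)`, with coefficients in `ℂ[G₂, G₄, G₆]`. -/
def liftSqrt : PowerSeries QMod :=
  PowerSeries.subst liftSqrtArg (PowerSeries.binomialSeries QMod (1 / 2 : ℚ))

theorem constantCoeff_liftSqrtArg : PowerSeries.constantCoeff liftSqrtArg = 0 := by
  simp [liftSqrtArg]

theorem liftSqrt_sq : liftSqrt ^ 2 = 1 + liftSqrtArg :=
  subst_binomialSeries_half_sq constantCoeff_liftSqrtArg

theorem map_liftRegular : PowerSeries.map (qExp : QMod →+* QSeries) liftRegular = wpRegular := by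
  ext1 m
  rw [PowerSeries.coeff_map, liftRegular, wpRegular, PowerSeries.coeff_mk, PowerSeries.coeff_mk]
  split_ifs with h
  · have := (liftG_spec (k := m + 2) (by omega)).2.2
    rw [← this]
    exact map_smul qExp _ _
  · exact map_zero qExp

theorem qExp_X_zero : qExp (MvPolynomial.X 0) = G 2 := by simp [qExp]

theorem map_liftSqrtArg : PowerSeries.map (qExp : QMod →+* QSeries) liftSqrtArg = sqrtArg := by
  rw [liftSqrtArg, map_mul, map_sub, map_pow, PowerSeries.map_X, map_liftRegular,
    PowerSeries.map_C, sqrtArg]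
  simp [qExp_X_zero, show qExp 4 = 4 from map_ofNat qExp 4]

theorem map_liftWpPlus : PowerSeries.map (qExp : QMod →+* QSeries) liftWpPlus = wpPlus := by
  rw [liftWpPlus, map_add, map_one, map_mul, map_add, map_pow, PowerSeries.map_X, map_liftRegular,
    PowerSeries.map_C, wpPlus]
  simp [qExp_X_zero, show qExp 2 = 2 from map_ofNat qExp 2]

theorem map_liftSqrt : PowerSeries.map (qExp : QMod →+* QSeries) liftSqrt = sqrtSeries := by
  apply eq_of_sq_eq_sq_of_constantCoeff
  · rw [← map_pow, liftSqrt_sq, map_add, map_one, map_liftSqrtArg, sqrtSeries_sq]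
  · have h : PowerSeries.constantCoeff liftSqrt = 1 :=
      constantCoeff_subst_binomialSeries constantCoeff_liftSqrtArg _
    have h' : PowerSeries.constantCoeff
        (PowerSeries.map (qExp : QMod →+* QSeries) liftSqrt) = 1 := by
      rw [← PowerSeries.coeff_zero_eq_constantCoeff_apply, PowerSeries.coeff_map,
        PowerSeries.coeff_zero_eq_constantCoeff_apply, h, map_one]
    rw [h', constantCoeff_sqrtSeries, one_add_one_eq_two]
    exact qSeries_two_ne_zero

/-! ### Weights -/

/-- A series in `z` over `ℂ[G₂, G₄, G₆]` that is homogeneous of weight `0` when `z` has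
weight `-1`. -/
def IsGraded (F : PowerSeries QMod) : Prop :=
  ∀ m, MvPolynomial.IsWeightedHomogeneous genWeight (PowerSeries.coeff m F) m

namespace IsGraded

variable {F H : PowerSeries QMod}

theorem one : IsGraded 1 := by
  intro m
  rw [PowerSeries.coeff_one]
  split_ifs with h
  · rw [h]
    exact MvPolynomial.isWeightedHomogeneous_one _ _
  · exact MvPolynomial.isWeightedHomogeneous_zero _ _ _

theorem add (hF : IsGraded F) (hH : IsGraded H) : IsGraded (F + H) := by
  intro m
  rw [map_add]
  exact (hF m).add (hH m)

theorem mul (hF : IsGraded F) (hH : IsGraded H) : IsGraded (F * H) := by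
  intro m
  rw [PowerSeries.coeff_mul]
  refine MvPolynomial.IsWeightedHomogeneous.sum _ _ _ fun p hp => ?_
  rw [← Finset.HasAntidiagonal.mem_antidiagonal.mp hp]
  exact (hF _).mul (hH _)

theorem pow (hF : IsGraded F) (n : ℕ) : IsGraded (F ^ n) := by
  induction n with
  | zero => simpa using one
  | succ n ih =>
    rw [pow_succ]
    exact ih.mul hF

theorem X_sq_mul (hF : ∀ m, MvPolynomial.IsWeightedHomogeneous genWeight
    (PowerSeries.coeff m F) (m + 2)) : IsGraded (PowerSeries.X ^ 2 * F) := by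
  intro m
  rw [PowerSeries.coeff_X_pow_mul']
  split_ifs with h
  · have := hF (m - 2)
    rwa [Nat.sub_add_cancel h] at this
  · exact MvPolynomial.isWeightedHomogeneous_zero _ _ _

theorem subst_binomialSeries (hF : IsGraded F) (hF0 : PowerSeries.constantCoeff F = 0) (r : ℚ) :
    IsGraded (PowerSeries.subst F (PowerSeries.binomialSeries QMod r)) := by
  intro m
  rw [coeff_subst_of_constantCoeff_zero hF0 _ m.lt_succ_self]
  refine MvPolynomial.IsWeightedHomogeneous.sum _ _ _ fun j _ => ?_
  rw [PowerSeries.binomialSeries_coeff, ← Algebra.algebraMap_eq_smul_one,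
    IsScalarTower.algebraMap_apply ℚ ℂ QMod, MvPolynomial.algebraMap_eq]
  exact (hF.pow j m).C_mul _

end IsGraded

theorem isWeightedHomogeneous_coeff_liftRegular (m : ℕ) :
    MvPolynomial.IsWeightedHomogeneous genWeight (PowerSeries.coeff m liftRegular) (m + 2) := by
  rw [liftRegular, PowerSeries.coeff_mk]
  split_ifs with h
  · exact (MvPolynomial.weightedHomogeneousSubmodule ℂ genWeight (m + 2)).smul_mem _
      (liftG_spec (by omega)).1
  · exact MvPolynomial.isWeightedHomogeneous_zero _ _ _

theorem isWeightedHomogeneous_coeff_C_X_zero (c : ℂ) (m : ℕ) :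
    MvPolynomial.IsWeightedHomogeneous genWeight
      (PowerSeries.coeff m (PowerSeries.C (MvPolynomial.C c * MvPolynomial.X 0 : QMod)))
      (m + 2) := by
  rw [PowerSeries.coeff_C]
  split_ifs with h
  · rw [h]
    exact (MvPolynomial.isWeightedHomogeneous_X ℂ genWeight 0).C_mul c
  · exact MvPolynomial.isWeightedHomogeneous_zero _ _ _

theorem isGraded_liftSqrt : IsGraded liftSqrt := by
  refine IsGraded.subst_binomialSeries ?_ constantCoeff_liftSqrtArg _
  refine IsGraded.X_sq_mul fun m => ?_
  rw [map_sub]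
  refine (isWeightedHomogeneous_coeff_liftRegular m).sub ?_
  have := isWeightedHomogeneous_coeff_C_X_zero 4 m
  rwa [map_ofNat] at this

theorem isGraded_liftWpPlus : IsGraded liftWpPlus := by
  refine IsGraded.one.add (IsGraded.X_sq_mul fun m => ?_)
  rw [map_add]
  refine (isWeightedHomogeneous_coeff_liftRegular m).add ?_
  have := isWeightedHomogeneous_coeff_C_X_zero 2 m
  rwa [map_ofNat] at this

/-! ### The derivation `d / d G₂` -/

/-- The derivation `d / d G₂`, applied to each coefficient of a power series in `z`. -/
def derivG2 : Derivation ℂ (PowerSeries QMod) (PowerSeries QMod) :=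
  Derivation.mk'
    { toFun := fun F => PowerSeries.mk fun m => MvPolynomial.pderiv 0 (PowerSeries.coeff m F)
      map_add' := by
        intro F H
        ext1 m
        simp
      map_smul' := by
        intro c F
        ext1 m
        rw [PowerSeries.coeff_mk, PowerSeries.coeff_smul, Derivation.map_smul, RingHom.id_apply,
          PowerSeries.coeff_smul, PowerSeries.coeff_mk] }
    (by
      intro F H
      ext1 m
      simp only [LinearMap.coe_mk, AddHom.coe_mk, PowerSeries.coeff_mk, smul_eq_mul, map_add,
        PowerSeries.coeff_mul, map_sum, Derivation.leibniz, Finset.sum_add_distrib]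
      congr 1
      exact Finset.Nat.sum_antidiagonal_swap (f := fun x =>
        PowerSeries.coeff x.1 H * MvPolynomial.pderiv 0 (PowerSeries.coeff x.2 F)))

theorem coeff_derivG2 (F : PowerSeries QMod) (m : ℕ) :
    PowerSeries.coeff m (derivG2 F) = MvPolynomial.pderiv 0 (PowerSeries.coeff m F) :=
  PowerSeries.coeff_mk m fun m => MvPolynomial.pderiv 0 (PowerSeries.coeff m F)

theorem derivG2_X_sq : derivG2 (PowerSeries.X ^ 2) = 0 := by
  ext1 m
  rw [coeff_derivG2, PowerSeries.coeff_X_pow]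
  split_ifs
  · exact Derivation.map_one_eq_zero _
  · simp

theorem derivG2_liftRegular : derivG2 liftRegular = 0 := by
  ext1 m
  rw [coeff_derivG2, liftRegular, PowerSeries.coeff_mk]
  split_ifs with h
  · rw [Derivation.map_smul, (liftG_spec (by omega)).2.1]
    simp
  · simp

theorem derivG2_C_X_zero (c : ℂ) :
    derivG2 (PowerSeries.C (MvPolynomial.C c * MvPolynomial.X 0 : QMod)) =
      PowerSeries.C (MvPolynomial.C c) := by
  ext1 m
  rw [coeff_derivG2, PowerSeries.coeff_C, PowerSeries.coeff_C]
  split_ifs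
  · simp [Derivation.leibniz]
  · simp

theorem derivG2_liftSqrtArg : derivG2 liftSqrtArg = -4 * PowerSeries.X ^ 2 := by
  have h := derivG2_C_X_zero 4
  simp only [map_ofNat] at h
  rw [liftSqrtArg, Derivation.leibniz, derivG2_X_sq, map_sub, derivG2_liftRegular, h]
  simp only [smul_eq_mul]
  ring

theorem derivG2_liftWpPlus : derivG2 liftWpPlus = 2 * PowerSeries.X ^ 2 := by
  have h := derivG2_C_X_zero 2
  simp only [map_ofNat] at h
  rw [liftWpPlus, map_add, Derivation.map_one_eq_zero, Derivation.leibniz, derivG2_X_sq, map_add,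
    derivG2_liftRegular, h]
  simp only [smul_eq_mul]
  ring

theorem liftSqrt_mul_derivG2 : liftSqrt * derivG2 liftSqrt = -2 * PowerSeries.X ^ 2 := by
  have h := congrArg derivG2 liftSqrt_sq
  rw [map_add, Derivation.map_one_eq_zero, derivG2_liftSqrtArg, pow_two, Derivation.leibniz] at h
  simp only [smul_eq_mul] at h
  have h2 : (2 : PowerSeries QMod) * (liftSqrt * derivG2 liftSqrt) =
      2 * (-2 * PowerSeries.X ^ 2) := by linear_combination h
  have h20 : (2 : PowerSeries QMod) ≠ 0 := powerSeries_two_ne_zero two_ne_zero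
  exact mul_left_cancel₀ h20 h2

theorem derivG2_liftSqrt_pow_mul_liftWpPlus (k : ℕ) :
    derivG2 (liftSqrt ^ (2 * k + 3) * liftWpPlus) =
      PowerSeries.X ^ 2 * (2 * liftSqrt ^ (2 * k + 3) -
        ((2 * (2 * k + 3) : ℕ) : PowerSeries QMod) * (liftSqrt ^ (2 * k + 1) * liftWpPlus)) := by
  rw [Derivation.leibniz, derivG2_liftWpPlus, Derivation.leibniz_pow]
  simp only [smul_eq_mul, nsmul_eq_mul]
  rw [show 2 * k + 3 - 1 = (2 * k + 1) + 1 by omega]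
  push_cast
  linear_combination (2 * (k : PowerSeries QMod) + 3) * liftSqrt ^ (2 * k + 1) * liftWpPlus *
    liftSqrt_mul_derivG2

/-! ### Quasimodularity of `B_k` -/

/-- A homogeneous polynomial with `q`-expansion `B_k`. -/
def liftB (k : ℕ) : QMod :=
  ((-1 : ℂ) ^ k / ((2 * k + 3).doubleFactorial : ℂ)) •
    PowerSeries.coeff (2 * k + 4) (liftSqrt ^ (2 * k + 3) * liftWpPlus)

theorem isWeightedHomogeneous_liftB (k : ℕ) :
    MvPolynomial.IsWeightedHomogeneous genWeight (liftB k) (2 * k + 4) :=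
  (MvPolynomial.weightedHomogeneousSubmodule ℂ genWeight (2 * k + 4)).smul_mem _
    (((isGraded_liftSqrt.pow _).mul isGraded_liftWpPlus) _)

theorem qExp_coeff (F : PowerSeries QMod) (m : ℕ) :
    qExp (PowerSeries.coeff m F) =
      PowerSeries.coeff m (PowerSeries.map (qExp : QMod →+* QSeries) F) :=
  (PowerSeries.coeff_map _ _ _).symm

theorem qExp_liftB (k : ℕ) : qExp (liftB k) = B k := by
  rw [liftB, map_smul, qExp_coeff, map_mul, map_pow, map_liftSqrt, map_liftWpPlus, B_eq_coeff]

/-- The residue of `(℘ - 4 G₂) ^ (1/2) (℘ + 2 G₂)` vanishes. -/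
theorem coeff_two_sqrtSeries_mul_wpPlus :
    PowerSeries.coeff 2 (sqrtSeries * wpPlus) = 0 := by
  have hs0 : PowerSeries.coeff 0 sqrtSeries = 1 := by
    rw [PowerSeries.coeff_zero_eq_constantCoeff_apply, constantCoeff_sqrtSeries]
  have h1 := congrArg (PowerSeries.coeff 1) sqrtSeries_sq
  have h2 := congrArg (PowerSeries.coeff 2) sqrtSeries_sq
  simp only [pow_two, PowerSeries.coeff_mul, Finset.Nat.sum_antidiagonal_eq_sum_range_succ_mk,
    Finset.sum_range_succ, Finset.sum_range_zero, map_add, hs0, sqrtArg, PowerSeries.coeff_one,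
    map_sub, Nat.sub_self, Nat.sub_zero, zero_add, one_mul, mul_one] at h1 h2
  simp [PowerSeries.coeff_X, wpRegular, PowerSeries.coeff_C, ← pow_two] at h1 h2
  have hs1 : PowerSeries.coeff 1 sqrtSeries = 0 := by
    have : (2 : QSeries) * PowerSeries.coeff 1 sqrtSeries = 0 := by linear_combination h1
    exact (mul_eq_zero.mp this).resolve_left qSeries_two_ne_zero
  simp only [PowerSeries.coeff_mul, Finset.Nat.sum_antidiagonal_eq_sum_range_succ_mk,
    Finset.sum_range_succ, Finset.sum_range_zero, hs0, hs1, wpPlus, zero_add]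
  simp [PowerSeries.coeff_X_pow_mul', wpRegular, PowerSeries.coeff_one]
  rw [hs1] at h2
  have : (2 : QSeries) * (2 * G 2 + PowerSeries.coeff 2 sqrtSeries) = 0 := by
    linear_combination h2
  exact (mul_eq_zero.mp this).resolve_left qSeries_two_ne_zero

theorem doubleFactorial_two_mul_add_three (k : ℕ) :
    ((2 * k + 3).doubleFactorial : ℂ) = (2 * k + 3) * ((2 * k + 1).doubleFactorial : ℂ) := by
  rw [show 2 * k + 3 = (2 * k + 1) + 2 by ring, Nat.doubleFactorial_add_two]
  push_cast
  ring

theorem qExp_pderiv_liftB (k : ℕ) :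
    qExp (MvPolynomial.pderiv 0 (liftB k)) = 2 * prev B k - 2 * A (k + 1) := by
  have hd := doubleFactorial_two_mul_add_three k
  have hd0 : ((2 * k + 1).doubleFactorial : ℂ) ≠ 0 := by
    exact_mod_cast (Nat.doubleFactorial_pos _).ne'
  have hk0 : (2 * k + 3 : ℂ) ≠ 0 := by exact_mod_cast (by omega : 2 * k + 3 ≠ 0)
  have hA : A (k + 1) = ((-1 : ℂ) ^ (k + 1) / ((2 * k + 3).doubleFactorial : ℂ)) •
      PowerSeries.coeff (2 * k + 2) (sqrtSeries ^ (2 * k + 3)) := A_eq_coeff (k + 1)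
  have hB : ((-1 : ℂ) ^ k / ((2 * k + 1).doubleFactorial : ℂ)) •
      PowerSeries.coeff (2 * k + 2) (sqrtSeries ^ (2 * k + 1) * wpPlus) = - prev B k := by
    cases k with
    | zero => simp [prev, coeff_two_sqrtSeries_mul_wpPlus]
    | succ k =>
      rw [prev, B_eq_coeff, ← neg_smul, pow_succ, mul_neg_one, neg_div]
      rfl
  rw [liftB, Derivation.map_smul, map_smul, ← coeff_derivG2, derivG2_liftSqrt_pow_mul_liftWpPlus,
    show 2 * k + 4 = (2 * k + 2) + 2 by ring, PowerSeries.coeff_X_pow_mul, qExp_coeff, map_sub,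
    map_mul, map_mul, map_mul, map_ofNat, map_natCast, map_pow, map_pow, map_liftSqrt,
    map_liftWpPlus, map_sub, ← nsmul_eq_mul (2 * (2 * k + 3)), map_nsmul,
    ← Nat.cast_ofNat (R := PowerSeries QSeries) (n := 2), ← nsmul_eq_mul, map_nsmul, hA,
    ← neg_neg (prev B k), ← hB]
  generalize PowerSeries.coeff (2 * k + 2) (sqrtSeries ^ (2 * k + 3)) = a
  generalize PowerSeries.coeff (2 * k + 2) (sqrtSeries ^ (2 * k + 1) * wpPlus) = b
  have h2 : ∀ x : QSeries, 2 * x = (2 : ℂ) • x := fun x => by rw [two_smul, two_mul]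
  rw [h2, h2]
  simp only [← Nat.cast_smul_eq_nsmul ℂ, hd]
  match_scalars
  · field_simp
    ring
  · field_simp

theorem isQuasimodular_B (k : ℕ) : IsQuasimodular (2 * k + 4) (B k) :=
  ⟨liftB k, isWeightedHomogeneous_liftB k, qExp_liftB k⟩

theorem hasG2Derivative_B (k : ℕ) : HasG2Derivative (B k) (2 * prev B k - 2 * A (k + 1)) := by
  refine ⟨⟨liftB k, qExp_liftB k⟩, fun P hP => ?_⟩
  have h := qExp_pderiv_eq_zero (P := P - liftB k) (by rw [map_sub, hP, qExp_liftB, sub_self])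
  rw [map_sub, map_sub, sub_eq_zero] at h
  rw [h, qExp_pderiv_liftB]

/-! ### The hyperbolic functions at `q = 0` -/

section Hyperbolic

open PowerSeries

/-- `z / (e ^ z - 1)`. -/
def bern : ℂ⟦X⟧ := bernoulliPowerSeries ℂ

/-- `e ^ (-z)`. -/
def expNeg : ℂ⟦X⟧ := evalNegHom (exp ℂ)

/-- `(z / 2) coth (z / 2)`, the value of `z (℘ - 4 G₂) ^ (1/2)` at `q = 0`. -/
def cothSeries : ℂ⟦X⟧ := bern + C (1 / 2) * X

/-- `z ^ 2 / (4 sinh ^ 2 (z / 2))`, the value of `z ^ 2 (℘ + 2 G₂)` at `q = 0`. -/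
def cschSq : ℂ⟦X⟧ := bern - X * derivative ℂ bern

/-- `4 sinh ^ 2 (z / 2)`. -/
def sinhSq : ℂ⟦X⟧ := exp ℂ + expNeg - 2

theorem bern_mul : bern * (exp ℂ - 1) = X := bernoulliPowerSeries_mul_exp_sub_one ℂ

theorem exp_mul_expNeg : exp ℂ * expNeg = 1 := exp_mul_exp_neg_eq_one

theorem exp_sub_one_ne_zero : exp ℂ - 1 ≠ 0 := by
  intro h
  have := bern_mul
  rw [h, mul_zero] at this
  exact X_ne_zero this.symm

theorem derivative_expNeg : derivative ℂ expNeg = -expNeg := by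
  have h := congrArg (derivative ℂ) exp_mul_expNeg
  rw [Derivation.leibniz, Derivation.map_one_eq_zero, derivative_exp] at h
  simp only [smul_eq_mul] at h
  linear_combination expNeg * h - (derivative ℂ expNeg + expNeg) * exp_mul_expNeg

theorem derivative_bern_mul : derivative ℂ bern * (exp ℂ - 1) + bern * exp ℂ = 1 := by
  have h := congrArg (derivative ℂ) bern_mul
  rw [Derivation.leibniz, derivative_X, map_sub, Derivation.map_one_eq_zero, derivative_exp] at h
  simp only [smul_eq_mul] at h
  linear_combination h

theorem cschSq_mul_sinhSq : cschSq * sinhSq = X ^ 2 := by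
  have h : cschSq * (exp ℂ - 1) ^ 2 = X ^ 2 * exp ℂ := by
    rw [cschSq]
    linear_combination (exp ℂ - 1 + X * exp ℂ) * bern_mul -
      X * (exp ℂ - 1) * derivative_bern_mul
  rw [sinhSq]
  linear_combination expNeg * h + (X ^ 2 - cschSq * (exp ℂ - 2)) * exp_mul_expNeg

theorem C_half_mul_two : (C (1 / 2) : ℂ⟦X⟧) * 2 = 1 := by
  rw [← map_ofNat C, ← map_mul]
  norm_num

theorem cothSeries_sq : cothSeries ^ 2 = cschSq + C (1 / 4) * X ^ 2 := by
  have h4 : (C (1 / 4) : ℂ⟦X⟧) = C (1 / 2) ^ 2 := by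
    rw [← map_pow]
    norm_num
  have h : bern ^ 2 + bern * X = bern - X * derivative ℂ bern := by
    apply mul_right_cancel₀ exp_sub_one_ne_zero
    linear_combination (bern - 1) * bern_mul + X * derivative_bern_mul
  rw [cothSeries, cschSq, h4]
  linear_combination h + bern * X * C_half_mul_two

theorem X_mul_derivative_cothSeries : X * derivative ℂ cothSeries = cothSeries - cschSq := by
  rw [cothSeries, cschSq, map_add, Derivation.leibniz, derivative_X, derivative_C]
  simp only [smul_eq_mul]
  ring

theorem X_mul_derivative_sinhSq : X * derivative ℂ sinhSq = 2 * cothSeries * sinhSq := by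
  have h2 : derivative ℂ (2 : ℂ⟦X⟧) = 0 := by
    rw [← map_ofNat C, derivative_C]
  rw [sinhSq, map_sub, map_add, h2, derivative_exp, derivative_expNeg, cothSeries]
  linear_combination (- 2 * (exp ℂ - 1) * expNeg) * bern_mul +
    (2 * bern * (exp ℂ - 2) - 2 * X) * exp_mul_expNeg -
    X * (exp ℂ + expNeg - 2) * C_half_mul_two

theorem constantCoeff_sinhSq : constantCoeff sinhSq = 0 := by
  have : constantCoeff expNeg = 1 := by
    have h := congrArg constantCoeff exp_mul_expNeg
    rwa [map_mul, constantCoeff_exp, one_mul, map_one] at h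
  rw [sinhSq, map_sub, map_add, constantCoeff_exp, this, map_ofNat]
  norm_num

theorem constantCoeff_cothSeries : constantCoeff cothSeries = 1 := by
  rw [cothSeries, map_add, map_mul, constantCoeff_X, mul_zero, add_zero, bern,
    bernoulliPowerSeries, ← coeff_zero_eq_constantCoeff_apply, coeff_mk]
  simp

/-! ### Residues of polynomials in `4 sinh ^ 2 (z / 2)` -/

theorem coeff_X_mul_derivative (F : ℂ⟦X⟧) (m : ℕ) :
    coeff m (X * derivative ℂ F) = m * coeff m F := by
  cases m with
  | zero => simp
  | succ m =>
    rw [coeff_succ_X_mul, coeff_derivative]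
    push_cast
    ring

/-- The residue of an exact differential: at `q = 0`, `(℘ + 2 G₂) dz` is `-dy`
for `y = coth (z / 2) / 2`. -/
theorem coeff_cothSeries_pow_mul_cschSq (N : ℕ) :
    coeff (2 * N + 2) (cothSeries ^ (2 * N + 1) * cschSq) = 0 := by
  have h := coeff_X_mul_derivative (cothSeries ^ (2 * N + 2)) (2 * N + 2)
  rw [Derivation.leibniz_pow] at h
  have h1 : X * ((2 * N + 2) • cothSeries ^ (2 * N + 2 - 1) • derivative ℂ cothSeries) =
      (2 * N + 2) • (cothSeries ^ (2 * N + 2) - cothSeries ^ (2 * N + 1) * cschSq) := by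
    rw [show 2 * N + 2 - 1 = 2 * N + 1 by omega, smul_eq_mul, nsmul_eq_mul, nsmul_eq_mul]
    linear_combination ((2 * N + 2 : ℕ) : ℂ⟦X⟧) * cothSeries ^ (2 * N + 1) *
      X_mul_derivative_cothSeries
  rw [h1, map_nsmul, nsmul_eq_mul, map_sub] at h
  have hN : ((2 * N + 2 : ℕ) : ℂ) ≠ 0 := by exact_mod_cast (by omega : 2 * N + 2 ≠ 0)
  have := mul_left_cancel₀ hN h
  linear_combination -this

/-- The residue of `y ^ (2 N + 1) v ^ i dz`, by Pascal's recursion from `y ^ 2 = 1 / 4 + 1 / v`. -/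
theorem coeff_cothSeries_pow_mul_sinhSq_pow (N i : ℕ) :
    (4 : ℂ) ^ N * coeff (2 * N) (cothSeries ^ (2 * N + 1) * sinhSq ^ i) =
      4 ^ i * (N.choose i : ℂ) := by
  induction N generalizing i with
  | zero =>
    rw [mul_zero, coeff_zero_eq_constantCoeff_apply, map_mul, map_pow, map_pow,
      constantCoeff_cothSeries, constantCoeff_sinhSq]
    cases i <;> simp
  | succ N ih =>
    cases i with
    | zero =>
      have h : cothSeries ^ (2 * (N + 1) + 1) * sinhSq ^ 0 =
          cothSeries ^ (2 * N + 1) * cschSq +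
            C (1 / 4) * (X ^ 2 * (cothSeries ^ (2 * N + 1) * sinhSq ^ 0)) := by
        linear_combination cothSeries ^ (2 * N + 1) * cothSeries_sq
      rw [h, show 2 * (N + 1) = 2 * N + 2 by ring, map_add, coeff_cothSeries_pow_mul_cschSq,
        coeff_C_mul, coeff_X_pow_mul, pow_succ]
      have := ih 0
      simp only [Nat.choose_zero_right] at this ⊢
      linear_combination this
    | succ i =>
      have h : cothSeries ^ (2 * (N + 1) + 1) * sinhSq ^ (i + 1) =
          X ^ 2 * (cothSeries ^ (2 * N + 1) * sinhSq ^ i) +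
            C (1 / 4) * (X ^ 2 * (cothSeries ^ (2 * N + 1) * sinhSq ^ (i + 1))) := by
        linear_combination cothSeries ^ (2 * N + 1) * sinhSq ^ (i + 1) * cothSeries_sq +
          cothSeries ^ (2 * N + 1) * sinhSq ^ i * cschSq_mul_sinhSq
      rw [h, show 2 * (N + 1) = 2 * N + 2 by ring, map_add, coeff_C_mul, coeff_X_pow_mul,
        coeff_X_pow_mul, pow_succ, Nat.choose_succ_succ]
      have h1 := ih i
      have h2 := ih (i + 1)
      push_cast
      have h3 : (4 : ℂ) ^ (i + 1) = 4 ^ i * 4 := pow_succ _ _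
      rw [h3] at h2 ⊢
      linear_combination 4 * h1 + h2

/-- The linear map on polynomials that sends `v ^ i` to `4 ^ i * binomial(x, i)`. -/
def binomMap : Polynomial ℂ →ₗ[ℂ] Polynomial ℂ :=
  Polynomial.lsum fun i => (4 ^ i / (i.factorial : ℂ)) •
    (LinearMap.toSpanSingleton ℂ (Polynomial ℂ) (descPochhammer ℂ i))

theorem binomMap_monomial (i : ℕ) (c : ℂ) :
    binomMap (Polynomial.monomial i c) =
      Polynomial.C (c * (4 ^ i / (i.factorial : ℂ))) * descPochhammer ℂ i := by
  rw [binomMap, Polynomial.lsum_apply, Polynomial.sum_monomial_index _ _ (by simp)]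
  simp [Polynomial.smul_eq_C_mul]
  ring

/-- The residue of `y ^ (2 N + 1) f(v) dz`, where `y = coth (z / 2) / 2` and
`v = 4 sinh ^ 2 (z / 2)`, is `4 ^ (-N)` times a polynomial in `N`. -/
theorem coeff_cothSeries_pow_mul_aeval (N : ℕ) (f : Polynomial ℂ) :
    (4 : ℂ) ^ N * coeff (2 * N) (cothSeries ^ (2 * N + 1) * Polynomial.aeval sinhSq f) =
      (binomMap f).eval (N : ℂ) := by
  induction f using Polynomial.induction_on' with
  | add f g hf hg =>
    rw [map_add, map_add, mul_add, map_add, mul_add, hf, hg, Polynomial.eval_add]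
  | monomial i c =>
    rw [binomMap_monomial, Polynomial.aeval_monomial, Polynomial.eval_mul, Polynomial.eval_C,
      descPochhammer_eval_eq_descFactorial, Nat.descFactorial_eq_factorial_mul_choose]
    have hi : (i.factorial : ℂ) ≠ 0 := by exact_mod_cast i.factorial_ne_zero
    have h : cothSeries ^ (2 * N + 1) * (algebraMap ℂ ℂ⟦X⟧ c * sinhSq ^ i) =
        C c * (cothSeries ^ (2 * N + 1) * sinhSq ^ i) := by
      rw [show algebraMap ℂ ℂ⟦X⟧ c = C c from rfl]
      ring
    rw [h, coeff_C_mul, mul_left_comm, coeff_cothSeries_pow_mul_sinhSq_pow]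
    push_cast
    field_simp

/-- The residue of `y ^ (2 N + 1) (f(v) / v + g(v)) dz`. The constant term of `f` contributes the
exact differential of a power of `y`, so that only `divX f` matters. -/
theorem coeff_cothSeries_pow_mul_aeval_add (N : ℕ) (f g : Polynomial ℂ) :
    (4 : ℂ) ^ N * coeff (2 * N + 2) (cothSeries ^ (2 * N + 1) *
      (cschSq * Polynomial.aeval sinhSq f + X ^ 2 * Polynomial.aeval sinhSq g)) =
      (binomMap (f.divX + g)).eval (N : ℂ) := by
  have hf : Polynomial.aeval sinhSq f =
      sinhSq * Polynomial.aeval sinhSq f.divX + C (f.coeff 0) := by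
    conv_lhs => rw [← Polynomial.divX_mul_X_add f]
    rw [map_add, map_mul, Polynomial.aeval_X, Polynomial.aeval_C, mul_comm]
    rfl
  have h : cothSeries ^ (2 * N + 1) *
      (cschSq * Polynomial.aeval sinhSq f + X ^ 2 * Polynomial.aeval sinhSq g) =
      C (f.coeff 0) * (cothSeries ^ (2 * N + 1) * cschSq) +
        X ^ 2 * (cothSeries ^ (2 * N + 1) * Polynomial.aeval sinhSq (f.divX + g)) := by
    rw [hf, map_add]
    linear_combination cothSeries ^ (2 * N + 1) * Polynomial.aeval sinhSq f.divX *
      cschSq_mul_sinhSq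
  rw [h, map_add, coeff_C_mul, coeff_cothSeries_pow_mul_cschSq, mul_zero, zero_add,
    coeff_X_pow_mul, coeff_cothSeries_pow_mul_aeval]

/-- Integration by parts: the residue of `y ^ (2 N + 1) (v' F)' dz` is `2 (2 N + 1)` times that
of `y ^ (2 N + 1) F dz`. -/
theorem coeff_cothSeries_pow_mul_derivative (N : ℕ) (F : ℂ⟦X⟧) :
    coeff (2 * N) (cothSeries ^ (2 * N + 1) * derivative ℂ (derivative ℂ sinhSq * F)) =
      (2 * N + 1) * (2 * coeff (2 * N) (cothSeries ^ (2 * N + 1) * F)) := by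
  set h := derivative ℂ sinhSq * F with hh
  have h1 := coeff_X_mul_derivative (cothSeries ^ (2 * N + 1) * h) (2 * N + 1)
  rw [Derivation.leibniz, Derivation.leibniz_pow, Nat.add_sub_cancel] at h1
  have h2 : X * (cothSeries ^ (2 * N + 1) • derivative ℂ h +
      h • ((2 * N + 1) • cothSeries ^ (2 * N) • derivative ℂ cothSeries)) =
      X * (cothSeries ^ (2 * N + 1) * derivative ℂ h) +
        (2 * N + 1) • (cothSeries ^ (2 * N + 1) * h - cothSeries ^ (2 * N) * cschSq * h) := by
    simp only [smul_eq_mul, nsmul_eq_mul]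
    linear_combination ((2 * N + 1 : ℕ) : ℂ⟦X⟧) * h * cothSeries ^ (2 * N) *
      X_mul_derivative_cothSeries
  have h3 : X * (cothSeries ^ (2 * N) * cschSq * h) =
      C 2 * (X ^ 2 * (cothSeries ^ (2 * N + 1) * F)) := by
    rw [hh, map_ofNat]
    linear_combination cothSeries ^ (2 * N) * cschSq * F * X_mul_derivative_sinhSq +
      2 * cothSeries ^ (2 * N + 1) * F * cschSq_mul_sinhSq
  have h4 := congrArg (coeff (2 * N + 2)) h3
  rw [coeff_succ_X_mul, coeff_C_mul, coeff_X_pow_mul] at h4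
  rw [h2, map_add, coeff_succ_X_mul, map_nsmul, map_sub, h4, nsmul_eq_mul] at h1
  push_cast at h1
  linear_combination h1

end Hyperbolic

/-! ### Hyperbolic cosines of multiples of `z` as polynomials -/

section Chebyshev

/-- The polynomial `p` with `p (4 sinh ^ 2 (z / 2)) = 2 cosh (d z)`. -/
def coshPoly : ℕ → Polynomial ℂ
  | 0 => 2
  | 1 => Polynomial.X + 2
  | d + 2 => (Polynomial.X + 2) * coshPoly (d + 1) - coshPoly d

/-- The polynomial `p` with `2 sinh z * p (4 sinh ^ 2 (z / 2)) = 2 sinh (d z)`. -/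
def sinhPoly : ℕ → Polynomial ℂ
  | 0 => 0
  | 1 => 1
  | d + 2 => (Polynomial.X + 2) * sinhPoly (d + 1) - sinhPoly d

open PowerSeries

theorem aeval_coshPoly : ∀ d : ℕ,
    Polynomial.aeval sinhSq (coshPoly d) = exp ℂ ^ d + expNeg ^ d
  | 0 => by
    rw [coshPoly, map_ofNat]
    norm_num
  | 1 => by
    rw [coshPoly, map_add, Polynomial.aeval_X, map_ofNat, sinhSq]
    ring
  | d + 2 => by
    rw [coshPoly, map_sub, map_mul, map_add, Polynomial.aeval_X, map_ofNat,
      aeval_coshPoly (d + 1), aeval_coshPoly d, sinhSq]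
    linear_combination (exp ℂ ^ d + expNeg ^ d) * exp_mul_expNeg

theorem derivative_sinhSq : derivative ℂ sinhSq = exp ℂ - expNeg := by
  have h2 : derivative ℂ (2 : ℂ⟦X⟧) = 0 := by
    rw [← map_ofNat C, derivative_C]
  rw [sinhSq, map_sub, map_add, h2, derivative_exp, derivative_expNeg]
  ring

theorem derivative_sinhSq_mul_aeval_sinhPoly : ∀ d : ℕ,
    derivative ℂ sinhSq * Polynomial.aeval sinhSq (sinhPoly d) = exp ℂ ^ d - expNeg ^ d
  | 0 => by simp [sinhPoly]
  | 1 => by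
    rw [sinhPoly, map_one, derivative_sinhSq]
    ring
  | d + 2 => by
    have h1 := derivative_sinhSq_mul_aeval_sinhPoly (d + 1)
    have h2 := derivative_sinhSq_mul_aeval_sinhPoly d
    rw [sinhPoly, map_sub, map_mul, map_add, Polynomial.aeval_X, map_ofNat]
    have hs : sinhSq = exp ℂ + expNeg - 2 := rfl
    linear_combination (sinhSq + 2) * h1 - h2 +
      (exp ℂ ^ d - expNeg ^ d) * exp_mul_expNeg + (exp ℂ ^ (d + 1) - expNeg ^ (d + 1)) * hs

theorem derivative_sinh (d : ℕ) :
    derivative ℂ (exp ℂ ^ d - expNeg ^ d) = (d : ℂ⟦X⟧) * (exp ℂ ^ d + expNeg ^ d) := by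
  cases d with
  | zero => simp
  | succ d =>
    rw [map_sub, Derivation.leibniz_pow, Derivation.leibniz_pow, derivative_exp, derivative_expNeg]
    simp only [smul_eq_mul, nsmul_eq_mul, Nat.add_sub_cancel]
    ring

theorem natDegree_coshPoly_le : ∀ d : ℕ, (coshPoly d).natDegree ≤ d
  | 0 => by
    rw [coshPoly]
    exact (Polynomial.natDegree_ofNat 2).le
  | 1 => by
    rw [coshPoly]
    compute_degree
  | d + 2 => by
    rw [coshPoly]
    refine (Polynomial.natDegree_sub_le _ _).trans (max_le ?_ ?_)
    · refine Polynomial.natDegree_mul_le.trans ?_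
      have h1 : (Polynomial.X + 2 : Polynomial ℂ).natDegree ≤ 1 := by compute_degree
      have h2 := natDegree_coshPoly_le (d + 1)
      omega
    · exact (natDegree_coshPoly_le d).trans (by omega)

theorem natDegree_sinhPoly_le : ∀ d : ℕ, (sinhPoly d).natDegree ≤ d - 1
  | 0 => by simp [sinhPoly]
  | 1 => by simp [sinhPoly]
  | d + 2 => by
    rw [sinhPoly]
    refine (Polynomial.natDegree_sub_le _ _).trans (max_le ?_ ?_)
    · refine Polynomial.natDegree_mul_le.trans ?_
      have h1 : (Polynomial.X + 2 : Polynomial ℂ).natDegree ≤ 1 := by compute_degree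
      have h2 := natDegree_sinhPoly_le (d + 1)
      omega
    · exact (natDegree_sinhPoly_le d).trans (by omega)

end Chebyshev

/-! ### Exchanging the variables `z` and `q` -/

section Swap

open PowerSeries

/-- Reading a power series in `z` over `ℂ⟦q⟧` as a power series in `q` over `ℂ⟦z⟧`. -/
def swapVars : PowerSeries QSeries →+* PowerSeries ℂ⟦X⟧ where
  toFun F := PowerSeries.mk fun n => PowerSeries.mk fun m => coeff n (coeff m F)
  map_zero' := by
    ext n m
    simp
  map_one' := by
    ext n m
    simp only [coeff_mk, coeff_one]
    split_ifs <;> simp_all [coeff_one]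
  map_add' F H := by
    ext n m
    simp
  map_mul' F H := by
    ext n m
    simp only [coeff_mk, coeff_mul, map_sum]
    exact Finset.sum_comm

theorem coeff_coeff_swapVars (F : PowerSeries QSeries) (n m : ℕ) :
    coeff m (coeff n (swapVars F)) = coeff n (coeff m F) := by
  simp [swapVars]

/-- The `q`-series whose `n`-th coefficient is the polynomial in `v = 4 sinh ^ 2 (z / 2)` equal
to the coefficient of `q ^ n` in `℘ + 2 G₂`, for `n ≥ 1`; its constant term is zero. -/
def polyPlus : PowerSeries (Polynomial ℂ) :=
  PowerSeries.mk fun n => ∑ d ∈ n.divisors, Polynomial.C (d : ℂ) * coshPoly d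

/-- The `q`-series whose `n`-th coefficient is the polynomial in `v = 4 sinh ^ 2 (z / 2)` equal
to the coefficient of `q ^ n` in `℘ - 4 G₂`, for `n ≥ 1`; its constant term is zero. -/
def polyMinus : PowerSeries (Polynomial ℂ) :=
  PowerSeries.mk fun n => ∑ d ∈ n.divisors, Polynomial.C (d : ℂ) * (coshPoly d - 6)

/-- Substitution of `4 sinh ^ 2 (z / 2)` in the coefficients of a series in `q`. -/
def evalSinhSq : PowerSeries (Polynomial ℂ) →+* PowerSeries ℂ⟦X⟧ :=
  PowerSeries.map (Polynomial.aeval sinhSq : Polynomial ℂ →ₐ[ℂ] ℂ⟦X⟧)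

theorem coeff_evalSinhSq (F : PowerSeries (Polynomial ℂ)) (n : ℕ) :
    coeff n (evalSinhSq F) = Polynomial.aeval sinhSq (coeff n F) :=
  PowerSeries.coeff_map _ _ _

theorem coeff_exp_pow (d m : ℕ) : coeff m (exp ℂ ^ d) = (d : ℂ) ^ m / m.factorial := by
  rw [exp_pow_eq_rescale_exp, coeff_rescale, coeff_exp]
  simp [div_eq_mul_inv]

theorem coeff_expNeg_pow (d m : ℕ) :
    coeff m (expNeg ^ d) = (-1) ^ m * ((d : ℂ) ^ m / m.factorial) := by
  rw [expNeg, ← map_pow, evalNegHom, coeff_rescale, coeff_exp_pow]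

theorem coeff_wpRegular_add (m : ℕ) :
    coeff m (wpRegular + C (2 * G 2)) = (2 / (m.factorial : ℂ)) • G (m + 2) := by
  rw [map_add, wpRegular, coeff_mk, coeff_C]
  match m with
  | 0 =>
    simp [two_smul, two_mul]
  | 1 =>
    have : G (1 + 2) = 0 := by
      rw [G, if_neg (by decide)]
    simp [this]
  | m + 2 => simp

theorem coeff_cschSq (m : ℕ) :
    coeff m cschSq = (1 - m) * ((bernoulli m : ℂ) / m.factorial) := by
  rw [cschSq, map_sub, coeff_X_mul_derivative, bern, bernoulliPowerSeries, coeff_mk]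
  simp
  ring

/-- The expansion of `z ^ 2 (℘ + 2 G₂)` in powers of `q`. -/
theorem swapVars_wpPlus :
    swapVars wpPlus = C cschSq + C (X ^ 2) * evalSinhSq polyPlus := by
  ext n m
  rw [coeff_coeff_swapVars, wpPlus, map_add, map_add, map_add, coeff_C_mul, map_add,
    coeff_evalSinhSq, polyPlus, coeff_mk, coeff_X_pow_mul', coeff_X_pow_mul', coeff_one, coeff_C]
  by_cases hm : 2 ≤ m
  · obtain ⟨j, rfl⟩ := Nat.exists_eq_add_of_le' hm
    have hf : (j.factorial : ℂ) ≠ 0 := by exact_mod_cast j.factorial_ne_zero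
    rw [if_pos hm, if_pos hm, Nat.add_sub_cancel, coeff_wpRegular_add, coeff_smul, G]
    have hG : coeff n (if Even (j + 2) then PowerSeries.mk fun n =>
        if n = 0 then -(bernoulli (j + 2) : ℂ) / (2 * ((j + 2 : ℕ) : ℂ)) else
          ∑ d ∈ n.divisors, (d : ℂ) ^ (j + 2 - 1) else (0 : QSeries)) = if Even j then
        if n = 0 then -(bernoulli (j + 2) : ℂ) / (2 * ((j + 2 : ℕ) : ℂ)) else
          ∑ d ∈ n.divisors, (d : ℂ) ^ (j + 1) else 0 := by
      simp only [Nat.even_add, even_two, iff_true]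
      split_ifs <;> simp_all
    rw [hG]
    by_cases hn : n = 0
    · subst hn
      simp only [if_true, Nat.divisors_zero, Finset.sum_empty, map_zero, add_zero]
      rw [coeff_cschSq]
      have h2 : (((j + 2).factorial : ℕ) : ℂ) = (j + 2) * ((j + 1) * j.factorial) := by
        rw [Nat.factorial_succ, Nat.factorial_succ]
        push_cast
        ring
      have hj1 : (j : ℂ) + 1 ≠ 0 := by exact_mod_cast j.succ_ne_zero
      have hj2 : (j : ℂ) + 2 ≠ 0 := by exact_mod_cast (j + 1).succ_ne_zero
      rw [if_neg (by omega), h2]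
      split_ifs with he
      · push_cast
        simp
        field_simp
        ring
      · rw [bernoulli_eq_zero_of_odd (by
          have := Nat.not_even_iff_odd.mp he
          exact this.add_even even_two) (by omega)]
        simp
    · simp only [hn, if_false, map_sum, map_mul, map_zero, zero_add, aeval_coshPoly]
      rw [if_neg (by omega), map_zero, zero_add]
      have hterm : ∀ d : ℕ, coeff j (Polynomial.aeval sinhSq (Polynomial.C (d : ℂ)) *
          (exp ℂ ^ d + expNeg ^ d)) = if Even j then 2 / (j.factorial : ℂ) * (d : ℂ) ^ (j + 1)
            else 0 := by
        intro d
        rw [Polynomial.aeval_C, show algebraMap ℂ ℂ⟦X⟧ (d : ℂ) = C (d : ℂ) from rfl, coeff_C_mul,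
          map_add, coeff_exp_pow, coeff_expNeg_pow]
        split_ifs with he
        · rw [he.neg_one_pow]
          field_simp
          ring
        · rw [(Nat.not_even_iff_odd.mp he).neg_one_pow]
          ring
      simp only [hterm]
      split_ifs with he
      · rw [smul_eq_mul, Finset.mul_sum]
      · simp
  · rw [if_neg hm, if_neg hm, map_zero, add_zero, add_zero]
    have : m = 0 ∨ m = 1 := by omega
    rcases this with rfl | rfl
    · by_cases hn : n = 0 <;> simp [hn, coeff_one, coeff_cschSq]
    · by_cases hn : n = 0 <;> simp [hn, coeff_cschSq]

/-- The expansion of `z ^ 2 (℘ - 4 G₂)` in powers of `q`. -/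
theorem swapVars_sqrtArg :
    swapVars (1 + sqrtArg) = C (cothSeries ^ 2) + C (X ^ 2) * evalSinhSq polyMinus := by
  have h1 : 1 + sqrtArg = wpPlus - X ^ 2 * C (6 * G 2) := by
    have : (C (6 * G 2) : PowerSeries QSeries) = C (4 * G 2) + C (2 * G 2) := by
      rw [← map_add]
      congr 1
      ring
    rw [wpPlus, sqrtArg, this]
    ring
  have h2 : swapVars (X ^ 2 * C (6 * G 2)) =
      C (X ^ 2) * (C (C (-(1 / 4))) + (evalSinhSq polyPlus - evalSinhSq polyMinus)) := by
    ext n m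
    rw [coeff_coeff_swapVars, coeff_X_pow_mul', coeff_C_mul, coeff_X_pow_mul']
    split_ifs with hm
    · rw [coeff_C, map_add, map_sub, coeff_evalSinhSq, coeff_evalSinhSq, polyPlus, polyMinus,
        coeff_mk, coeff_mk, ← map_sub, ← Finset.sum_sub_distrib, coeff_C]
      have h6 : (6 : QSeries) = C 6 := (map_ofNat C 6).symm
      have hsum : Polynomial.aeval sinhSq (∑ d ∈ n.divisors, (Polynomial.C (d : ℂ) * coshPoly d -
          Polynomial.C (d : ℂ) * (coshPoly d - 6))) = C (6 * ∑ d ∈ n.divisors, (d : ℂ)) := by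
        rw [map_sum, Finset.mul_sum, map_sum]
        refine Finset.sum_congr rfl fun d _ => ?_
        rw [← mul_sub, sub_sub_cancel, map_mul, map_ofNat, Polynomial.aeval_C, map_mul, map_ofNat]
        rw [mul_comm]
        rfl
      rw [hsum, map_add, coeff_C]
      by_cases hm0 : m - 2 = 0
      · rw [hm0, if_pos rfl, h6, coeff_C_mul, G, if_pos (by decide), coeff_mk]
        by_cases hn : n = 0
        · simp [hn, bernoulli_two]
          norm_num
        · simp [hn]
      · rw [if_neg hm0]
        by_cases hn : n = 0 <;> simp [hn, hm0, coeff_C]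
    · simp
  rw [h1, map_sub, h2, swapVars_wpPlus, cothSeries_sq]
  simp only [map_add, map_mul, map_neg]
  ring

end Swap

/-! ### The coefficients of `B_k` -/

section Expansion

open PowerSeries

theorem choose_eq_prod_div (r : ℚ) (j : ℕ) :
    Ring.choose r j = (∏ l ∈ Finset.range j, (r - l)) / j.factorial := by
  have h : (descPochhammer ℤ j).smeval r = ∏ l ∈ Finset.range j, (r - l) := by
    induction j with
    | zero => simp
    | succ j ih =>
      rw [descPochhammer_succ_right, Polynomial.smeval_mul, ih, Finset.prod_range_succ,
        Polynomial.smeval_sub, Polynomial.smeval_X, Polynomial.smeval_natCast, npow_one, npow_zero,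
        nsmul_one]
  have hj : (j.factorial : ℚ) ≠ 0 := by exact_mod_cast j.factorial_ne_zero
  rw [← h, Ring.descPochhammer_eq_factorial_smul_choose, nsmul_eq_mul]
  field_simp

theorem polyMinus_coeff_zero : coeff 0 polyMinus = 0 := by simp [polyMinus]

theorem polyPlus_coeff_zero : coeff 0 polyPlus = 0 := by simp [polyPlus]

/-- Expansion of `(℘ - 4 G₂) ^ (k + 3/2) (℘ + 2 G₂)` in powers of `q` around its value at
`q = 0`, by the binomial series. Up to `q ^ (k + 1)` only positive powers of
`coth (z / 2) / 2` occur. -/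
theorem coeff_swapVars_sqrtSeries_pow {n k : ℕ} (hn : n ≤ k + 1) :
    coeff n (swapVars (sqrtSeries ^ (2 * k + 3) * wpPlus)) =
      ∑ j ∈ Finset.range (n + 1), C ((Ring.choose (((2 * k + 3 : ℕ) : ℚ) / 2) j : ℚ) : ℂ) *
        (X ^ (2 * j) * (cothSeries ^ (2 * (k + 1 - j) + 1) *
          (cschSq * Polynomial.aeval sinhSq (coeff n (polyMinus ^ j)) +
            X ^ 2 * Polynomial.aeval sinhSq (coeff n (polyMinus ^ j * polyPlus))))) := by
  have hT : cothSeries * cothSeries⁻¹ = 1 :=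
    PowerSeries.mul_inv_cancel _ (by rw [constantCoeff_cothSeries]; exact one_ne_zero)
  set Φ := evalSinhSq polyMinus with hΦ
  set ε : PowerSeries ℂ⟦X⟧ := C (X ^ 2 * cothSeries⁻¹ ^ 2) * Φ with hε
  have hΦ0 : constantCoeff Φ = 0 := by
    rw [← coeff_zero_eq_constantCoeff_apply, hΦ, coeff_evalSinhSq, polyMinus_coeff_zero, map_zero]
  have hε0 : constantCoeff ε = 0 := by rw [hε, map_mul, hΦ0, mul_zero]
  set b : PowerSeries ℂ⟦X⟧ := subst ε (binomialSeries ℂ⟦X⟧ (1 / 2 : ℚ)) with hb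
  have hs : swapVars sqrtSeries = C cothSeries * b := by
    apply eq_of_sq_eq_sq_of_constantCoeff
    · rw [← map_pow, sqrtSeries_sq, swapVars_sqrtArg, mul_pow, hb,
        subst_binomialSeries_half_sq hε0, hε, ← hΦ]
      have hC : (C cothSeries * C cothSeries⁻¹ : PowerSeries ℂ⟦X⟧) = 1 := by
        rw [← map_mul, hT, map_one]
      simp only [map_mul, map_pow]
      linear_combination (-(C cothSeries * C cothSeries⁻¹ + 1)) * C X ^ 2 * Φ * hC
    · intro h
      have h1 := congrArg constantCoeff h
      rw [map_mul, hb, constantCoeff_subst_binomialSeries hε0, mul_one, constantCoeff_C, map_add,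
        constantCoeff_cothSeries, map_zero] at h1
      have h2 : constantCoeff (constantCoeff (swapVars sqrtSeries)) = 1 := by
        rw [← coeff_zero_eq_constantCoeff_apply, ← coeff_zero_eq_constantCoeff_apply,
          coeff_coeff_swapVars, coeff_zero_eq_constantCoeff_apply,
          coeff_zero_eq_constantCoeff_apply, constantCoeff_sqrtSeries, map_one]
      rw [h2] at h1
      norm_num at h1
  have hbpow : b ^ (2 * k + 3) =
      subst ε (binomialSeries ℂ⟦X⟧ (((2 * k + 3 : ℕ) : ℚ) / 2)) := by
    rw [hb, ← subst_pow (HasSubst.of_constantCoeff_zero' hε0), binomialSeries_half_pow]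
  have hprod : coeff n (b ^ (2 * k + 3) * swapVars wpPlus) =
      ∑ j ∈ Finset.range (n + 1), C ((Ring.choose (((2 * k + 3 : ℕ) : ℚ) / 2) j : ℚ) : ℂ) *
        coeff n (ε ^ j * swapVars wpPlus) := by
    simp only [coeff_mul, Finset.mul_sum]
    rw [Finset.sum_comm]
    refine Finset.sum_congr rfl fun p hp => ?_
    have hp1 : p.1 < n + 1 := by
      have := Finset.HasAntidiagonal.mem_antidiagonal.mp hp
      omega
    rw [hbpow, coeff_subst_of_constantCoeff_zero hε0 _ hp1, Finset.sum_mul]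
    refine Finset.sum_congr rfl fun j _ => ?_
    rw [binomialSeries_coeff, ← Algebra.algebraMap_eq_smul_one,
      IsScalarTower.algebraMap_apply ℚ ℂ ℂ⟦X⟧, mul_assoc]
    rfl
  rw [map_mul, map_pow, hs, mul_pow, mul_assoc, ← map_pow, coeff_C_mul, hprod, Finset.mul_sum]
  refine Finset.sum_congr rfl fun j hj => ?_
  have hjk : j ≤ k + 1 := (Nat.lt_succ_iff.mp (Finset.mem_range.mp hj)).trans hn
  have hpow : cothSeries ^ (2 * k + 3) * cothSeries⁻¹ ^ (2 * j) =
      cothSeries ^ (2 * (k + 1 - j) + 1) := by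
    rw [show 2 * k + 3 = (2 * (k + 1 - j) + 1) + 2 * j by omega, pow_add, mul_assoc, ← mul_pow, hT,
      one_pow, mul_one]
  have hexp : ε ^ j * swapVars wpPlus = C (X ^ (2 * j) * cothSeries⁻¹ ^ (2 * j)) *
      (C cschSq * evalSinhSq (polyMinus ^ j) +
        C (X ^ 2) * evalSinhSq (polyMinus ^ j * polyPlus)) := by
    rw [hε, swapVars_wpPlus, mul_pow, ← map_pow, mul_pow, ← pow_mul, ← pow_mul, map_mul evalSinhSq,
      map_pow evalSinhSq]
    ring
  rw [hexp, coeff_C_mul, map_add, coeff_C_mul, coeff_C_mul, coeff_evalSinhSq, coeff_evalSinhSq,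
    ← hpow]
  ring

/-- The polynomial in `4 sinh ^ 2 (z / 2)` whose residue against odd powers of
`coth (z / 2) / 2` is the contribution of the `j`-th binomial term to the coefficient of
`q ^ n`. -/
def termPoly (n j : ℕ) : Polynomial ℂ :=
  (coeff n (polyMinus ^ j)).divX + coeff n (polyMinus ^ j * polyPlus)

theorem coeff_coeff_sqrtSeries_pow {n k : ℕ} (hn : n ≤ k + 1) :
    coeff n (coeff (2 * k + 4) (sqrtSeries ^ (2 * k + 3) * wpPlus)) =
      ∑ j ∈ Finset.range (n + 1), ((Ring.choose (((2 * k + 3 : ℕ) : ℚ) / 2) j : ℚ) : ℂ) *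
        ((binomMap (termPoly n j)).eval ((k + 1 - j : ℕ) : ℂ) / 4 ^ (k + 1 - j)) := by
  rw [← coeff_coeff_swapVars, coeff_swapVars_sqrtSeries_pow hn, map_sum]
  refine Finset.sum_congr rfl fun j hj => ?_
  have hjk : j ≤ k + 1 := (Nat.lt_succ_iff.mp (Finset.mem_range.mp hj)).trans hn
  rw [coeff_C_mul, show 2 * k + 4 = (2 * (k + 1 - j) + 2) + 2 * j by omega, coeff_X_pow_mul,
    termPoly, ← coeff_cothSeries_pow_mul_aeval_add]
  congr 1
  rw [mul_div_cancel_left₀]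
  exact pow_ne_zero _ (by norm_num)

/-- The zeroth binomial term: by integration by parts its residue is divisible by `2 k + 3`. -/
theorem binomMap_termPoly_zero (n k : ℕ) :
    (binomMap (termPoly n 0)).eval ((k + 1 : ℕ) : ℂ) =
      2 * (2 * k + 3) * (binomMap (∑ d ∈ n.divisors, sinhPoly d)).eval ((k + 1 : ℕ) : ℂ) := by
  have h0 : termPoly n 0 = ∑ d ∈ n.divisors, Polynomial.C (d : ℂ) * coshPoly d := by
    rw [termPoly, pow_zero, one_mul, coeff_one, polyPlus, coeff_mk]
    split_ifs
    · rw [← Polynomial.C_1, Polynomial.divX_C, zero_add]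
    · rw [Polynomial.divX_zero, zero_add]
  have h1 : Polynomial.aeval sinhSq (∑ d ∈ n.divisors, Polynomial.C (d : ℂ) * coshPoly d) =
      derivative ℂ (derivative ℂ sinhSq *
        Polynomial.aeval sinhSq (∑ d ∈ n.divisors, sinhPoly d)) := by
    rw [map_sum, map_sum, Finset.mul_sum, map_sum]
    refine Finset.sum_congr rfl fun d _ => ?_
    rw [derivative_sinhSq_mul_aeval_sinhPoly, derivative_sinh, map_mul, aeval_coshPoly]
    simp
  rw [h0, ← coeff_cothSeries_pow_mul_aeval, ← coeff_cothSeries_pow_mul_aeval, h1,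
    coeff_cothSeries_pow_mul_derivative]
  push_cast
  ring

/-- The product `(x + 1/2) (x - 1/2) ⋯ (x + 3/2 - j)`. -/
def halfFalling (j : ℕ) : Polynomial ℂ :=
  ∏ l ∈ Finset.range j, (Polynomial.X + Polynomial.C (1 / 2 - (l : ℂ)))

/-- The summand of `coeffPoly` that comes from the `(j + 1)`-st binomial term. -/
def coeffPolyTerm (n j : ℕ) : Polynomial ℂ :=
  Polynomial.C (4 ^ j / (2 * ((j + 1).factorial : ℂ))) * (halfFalling j *
    (binomMap (termPoly n (j + 1))).comp (Polynomial.X + Polynomial.C (-(j : ℂ))))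

/-- The polynomial that gives the coefficient of `q ^ n` in `B_k`. -/
def coeffPoly (n : ℕ) : Polynomial ℂ :=
  Polynomial.C (1 / 2) * (binomMap (∑ d ∈ n.divisors, sinhPoly d)).comp
      (Polynomial.X + Polynomial.C 1) + ∑ j ∈ Finset.range n, coeffPolyTerm n j

theorem eval_halfFalling (j : ℕ) (x : ℂ) :
    (halfFalling j).eval x = ∏ l ∈ Finset.range j, (x + (1 / 2 - (l : ℂ))) := by
  rw [halfFalling, Polynomial.eval_prod]
  simp

theorem factorial_two_mul_add_one (k : ℕ) :
    ((2 * k + 1).factorial : ℂ) = ((2 * k + 1).doubleFactorial : ℂ) * (2 ^ k * k.factorial) := by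
  rw [Nat.factorial_eq_mul_doubleFactorial, Nat.doubleFactorial_two_mul]
  push_cast
  ring

/-- The coefficient of `q ^ n` in `B_k` for `k ≥ n - 1`. -/
theorem coeff_B {n k : ℕ} (hn : n ≤ k + 1) :
    coeff n (B k) = (k.factorial : ℂ) / (((2 * k + 1).factorial : ℂ) * (-2 : ℂ) ^ k) *
      (coeffPoly n).eval (k : ℂ) := by
  have hd := doubleFactorial_two_mul_add_three k
  have hd0 : ((2 * k + 1).doubleFactorial : ℂ) ≠ 0 := by
    exact_mod_cast (Nat.doubleFactorial_pos _).ne'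
  have hf0 : (k.factorial : ℂ) ≠ 0 := by exact_mod_cast k.factorial_ne_zero
  have hk0 : (2 * k + 3 : ℂ) ≠ 0 := by exact_mod_cast (by omega : 2 * k + 3 ≠ 0)
  have hpre : (k.factorial : ℂ) / (((2 * k + 1).factorial : ℂ) * (-2 : ℂ) ^ k) =
      (-1) ^ k / (((2 * k + 1).doubleFactorial : ℂ) * 4 ^ k) := by
    rw [factorial_two_mul_add_one, show (-2 : ℂ) ^ k = (-1) ^ k * 2 ^ k by rw [← mul_pow]; norm_num,
      show (4 : ℂ) ^ k = 2 ^ k * 2 ^ k by rw [← mul_pow]; norm_num]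
    have h1 : ((-1 : ℂ) ^ k) * (-1) ^ k = 1 := by rw [← mul_pow]; norm_num
    have h2 : (-1 : ℂ) ^ k ≠ 0 := pow_ne_zero _ (by norm_num)
    field_simp
    linear_combination -h1
  have hterm : ∀ j ∈ Finset.range n,
      ((Ring.choose (((2 * k + 3 : ℕ) : ℚ) / 2) (j + 1) : ℚ) : ℂ) *
        ((binomMap (termPoly n (j + 1))).eval ((k + 1 - (j + 1) : ℕ) : ℂ) /
          4 ^ (k + 1 - (j + 1))) =
      (2 * k + 3) / 4 ^ k * (coeffPolyTerm n j).eval (k : ℂ) := by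
    intro j hj
    have hjk : j ≤ k := by
      have := Finset.mem_range.mp hj
      omega
    have h4 : (4 : ℂ) ^ k = 4 ^ (k - j) * 4 ^ j := by rw [← pow_add, Nat.sub_add_cancel hjk]
    have hj0 : ((j + 1).factorial : ℂ) ≠ 0 := by exact_mod_cast (j + 1).factorial_ne_zero
    rw [choose_eq_prod_div, Finset.prod_range_succ', coeffPolyTerm, Polynomial.eval_mul,
      Polynomial.eval_mul, Polynomial.eval_C, eval_halfFalling, Polynomial.eval_comp,
      Polynomial.eval_add, Polynomial.eval_X, Polynomial.eval_C, h4,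
      show k + 1 - (j + 1) = k - j by omega, Nat.cast_sub hjk]
    -- The factors after the first, `(2 k + 3) / 2 - (l + 1)`, make up `halfFalling`.
    have hprod : ((∏ l ∈ Finset.range j, (((2 * k + 3 : ℕ) : ℚ) / 2 - ((l + 1 : ℕ) : ℚ)) : ℚ) : ℂ) =
        ∏ l ∈ Finset.range j, ((k : ℂ) + (1 / 2 - (l : ℂ))) := by
      push_cast
      refine Finset.prod_congr rfl fun l _ => ?_
      ring
    push_cast at hprod ⊢
    rw [hprod, ← sub_eq_add_neg]
    field_simp
    ring
  have hzero : ((Ring.choose (((2 * k + 3 : ℕ) : ℚ) / 2) 0 : ℚ) : ℂ) *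
        ((binomMap (termPoly n 0)).eval ((k + 1 - 0 : ℕ) : ℂ) / 4 ^ (k + 1 - 0)) =
      (2 * k + 3) / 4 ^ k * (1 / 2 *
        (binomMap (∑ d ∈ n.divisors, sinhPoly d)).eval ((k : ℂ) + 1)) := by
    rw [Nat.sub_zero, binomMap_termPoly_zero, Ring.choose_zero_right]
    push_cast
    rw [pow_succ]
    field_simp
    ring
  rw [B_eq_coeff, coeff_smul, coeff_coeff_sqrtSeries_pow hn, Finset.sum_range_succ', hzero,
    Finset.sum_congr rfl hterm, ← Finset.mul_sum, ← mul_add, hpre, coeffPoly, Polynomial.eval_add,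
    Polynomial.eval_finsetSum, Polynomial.eval_mul, Polynomial.eval_C, Polynomial.eval_comp,
    Polynomial.eval_add, Polynomial.eval_X, Polynomial.eval_C, hd, smul_eq_mul]
  field_simp
  ring

end Expansion

/-! ### The degree of `coeffPoly` -/

section Degree

open Polynomial

theorem natDegree_binomMap_le {f : ℂ[X]} {N : ℕ} (hf : f.natDegree ≤ N) :
    (binomMap f).natDegree ≤ N := by
  rw [f.as_sum_range' (N + 1) (Nat.lt_succ_of_le hf), map_sum]
  refine natDegree_sum_le_of_forall_le _ _ fun i hi => ?_
  rw [binomMap_monomial]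
  refine (natDegree_C_mul_le _ _).trans ?_
  rw [descPochhammer_natDegree]
  exact Nat.lt_succ_iff.mp (Finset.mem_range.mp hi)

theorem coeff_binomMap {f : ℂ[X]} {N : ℕ} (hf : f.natDegree ≤ N) :
    (binomMap f).coeff N = f.coeff N * (4 ^ N / (N.factorial : ℂ)) := by
  conv_lhs => rw [f.as_sum_range' (N + 1) (Nat.lt_succ_of_le hf)]
  rw [map_sum, finsetSum_coeff, Finset.sum_range_succ, Finset.sum_eq_zero, zero_add,
    binomMap_monomial, coeff_C_mul]
  · have h := (monic_descPochhammer ℂ N).coeff_natDegree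
    rw [descPochhammer_natDegree] at h
    rw [h, mul_one]
  · intro i hi
    have h : (descPochhammer ℂ i).coeff N = 0 := coeff_eq_zero_of_natDegree_lt (by
      rw [descPochhammer_natDegree]
      exact Finset.mem_range.mp hi)
    rw [binomMap_monomial, coeff_C_mul, h, mul_zero]

theorem natDegree_comp_X_add_C_le {f : ℂ[X]} {N : ℕ} (hf : f.natDegree ≤ N) (a : ℂ) :
    (f.comp (X + C a)).natDegree ≤ N := by
  rw [natDegree_comp, natDegree_X_add_C, mul_one]
  exact hf

theorem coeff_comp_X_add_C {f : ℂ[X]} {N : ℕ} (hf : f.natDegree ≤ N) (a : ℂ) :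
    (f.comp (X + C a)).coeff N = f.coeff N := by
  rcases hf.lt_or_eq with h | h
  · rw [coeff_eq_zero_of_natDegree_lt h, coeff_eq_zero_of_natDegree_lt]
    rwa [natDegree_comp, natDegree_X_add_C, mul_one]
  · have h1 := leadingCoeff_comp (p := f) (q := X + C a)
      (by rw [natDegree_X_add_C]; exact one_ne_zero)
    rw [leadingCoeff, leadingCoeff, natDegree_comp, natDegree_X_add_C, mul_one, h,
      leadingCoeff_X_add_C, one_pow, mul_one] at h1
    exact h1

theorem monic_halfFalling (j : ℕ) : (halfFalling j).Monic :=
  monic_prod_of_monic _ _ fun _ _ => monic_X_add_C _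

theorem natDegree_halfFalling (j : ℕ) : (halfFalling j).natDegree = j := by
  rw [halfFalling, natDegree_prod_of_monic _ _ fun _ _ => monic_X_add_C _]
  simp only [natDegree_X_add_C, Finset.sum_const, Finset.card_range, smul_eq_mul, mul_one]

theorem coeff_halfFalling (j : ℕ) : (halfFalling j).coeff j = 1 := by
  have h := (monic_halfFalling j).coeff_natDegree
  rwa [natDegree_halfFalling] at h

/-- Power series with polynomial coefficients such that the degree of the `n`-th coefficient is at
most `n`. -/
def GradedDegree (F : PowerSeries ℂ[X]) : Prop :=
  ∀ n, (PowerSeries.coeff n F).natDegree ≤ n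

theorem GradedDegree.mul {F F' : PowerSeries ℂ[X]} (hF : GradedDegree F) (hF' : GradedDegree F') :
    GradedDegree (F * F') := by
  intro n
  rw [PowerSeries.coeff_mul]
  refine natDegree_sum_le_of_forall_le _ _ fun p hp => ?_
  rw [← Finset.HasAntidiagonal.mem_antidiagonal.mp hp]
  exact natDegree_mul_le.trans (add_le_add (hF _) (hF' _))

theorem GradedDegree.pow {F : PowerSeries ℂ[X]} (hF : GradedDegree F) (j : ℕ) :
    GradedDegree (F ^ j) := by
  induction j with
  | zero =>
    intro n
    rw [pow_zero, PowerSeries.coeff_one]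
    split_ifs <;> simp
  | succ j ih =>
    rw [pow_succ]
    exact ih.mul hF

theorem gradedDegree_polyPlus : GradedDegree polyPlus := by
  intro n
  rw [polyPlus, PowerSeries.coeff_mk]
  refine natDegree_sum_le_of_forall_le _ _ fun d hd => ?_
  exact (natDegree_C_mul_le _ _).trans
    ((natDegree_coshPoly_le d).trans (Nat.divisor_le hd))

theorem gradedDegree_polyMinus : GradedDegree polyMinus := by
  intro n
  rw [polyMinus, PowerSeries.coeff_mk]
  refine natDegree_sum_le_of_forall_le _ _ fun d hd => ?_
  refine (natDegree_C_mul_le _ _).trans (((natDegree_sub_le _ _).trans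
    (max_le (natDegree_coshPoly_le d) ?_)).trans (Nat.divisor_le hd))
  exact (natDegree_ofNat 6).le.trans (Nat.zero_le _)

theorem coeff_one_polyPlus : PowerSeries.coeff 1 polyPlus = X + C 2 := by
  rw [polyPlus, PowerSeries.coeff_mk]
  simp [coshPoly, map_ofNat C]

theorem coeff_one_polyMinus : PowerSeries.coeff 1 polyMinus = X + C (-4) := by
  rw [polyMinus, PowerSeries.coeff_mk]
  simp [coshPoly, map_ofNat C]
  ring

theorem exists_polyMinus_eq_X_mul : ∃ M : PowerSeries ℂ[X],
    polyMinus = PowerSeries.X * M ∧ PowerSeries.constantCoeff M = X + C (-4) := by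
  obtain ⟨M, hM⟩ := PowerSeries.X_dvd_iff.mpr
    ((PowerSeries.coeff_zero_eq_constantCoeff_apply _).symm.trans polyMinus_coeff_zero)
  refine ⟨M, hM, ?_⟩
  rw [← coeff_one_polyMinus, hM, ← PowerSeries.coeff_zero_eq_constantCoeff_apply]
  exact (PowerSeries.coeff_succ_X_mul 0 M).symm

theorem exists_polyPlus_eq_X_mul : ∃ M : PowerSeries ℂ[X],
    polyPlus = PowerSeries.X * M ∧ PowerSeries.constantCoeff M = X + C 2 := by
  obtain ⟨M, hM⟩ := PowerSeries.X_dvd_iff.mpr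
    ((PowerSeries.coeff_zero_eq_constantCoeff_apply _).symm.trans polyPlus_coeff_zero)
  refine ⟨M, hM, ?_⟩
  rw [← coeff_one_polyPlus, hM, ← PowerSeries.coeff_zero_eq_constantCoeff_apply]
  exact (PowerSeries.coeff_succ_X_mul 0 M).symm

theorem coeff_polyMinus_pow (n : ℕ) :
    PowerSeries.coeff n (polyMinus ^ n) = (X + C (-4)) ^ n := by
  obtain ⟨M, hM, hM0⟩ := exists_polyMinus_eq_X_mul
  have h := PowerSeries.coeff_X_pow_mul (M ^ n) n 0
  rw [zero_add] at h
  rw [hM, mul_pow, h, PowerSeries.coeff_zero_eq_constantCoeff_apply, map_pow, hM0]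

theorem coeff_polyMinus_pow_mul_polyPlus (n : ℕ) :
    PowerSeries.coeff (n + 1) (polyMinus ^ n * polyPlus) = (X + C (-4)) ^ n * (X + C 2) := by
  obtain ⟨M, hM, hM0⟩ := exists_polyMinus_eq_X_mul
  obtain ⟨P, hP, hP0⟩ := exists_polyPlus_eq_X_mul
  have h := PowerSeries.coeff_X_pow_mul (M ^ n * P) (n + 1) 0
  rw [zero_add] at h
  rw [hM, hP, show (PowerSeries.X * M) ^ n * (PowerSeries.X * P) =
    PowerSeries.X ^ (n + 1) * (M ^ n * P) by ring, h, PowerSeries.coeff_zero_eq_constantCoeff_apply,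
    map_mul, map_pow, hM0, hP0]

theorem coeff_polyMinus_pow_mul_polyPlus_self (n : ℕ) :
    PowerSeries.coeff n (polyMinus ^ n * polyPlus) = 0 := by
  obtain ⟨M, hM, hM0⟩ := exists_polyMinus_eq_X_mul
  obtain ⟨P, hP, hP0⟩ := exists_polyPlus_eq_X_mul
  refine PowerSeries.X_pow_dvd_iff.mp (Dvd.intro (M ^ n * P) ?_) n (Nat.lt_succ_self n)
  rw [hM, hP, pow_succ]
  ring

theorem natDegree_divX_coeff_polyMinus_pow_le (n j : ℕ) :
    (PowerSeries.coeff n (polyMinus ^ j)).divX.natDegree ≤ n - 1 := by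
  rw [natDegree_divX_eq_natDegree_tsub_one]
  exact Nat.sub_le_sub_right (gradedDegree_polyMinus.pow j n) 1

theorem natDegree_termPoly_le (n j : ℕ) : (termPoly n j).natDegree ≤ n :=
  (natDegree_add_le _ _).trans (max_le
    ((natDegree_divX_coeff_polyMinus_pow_le n j).trans (Nat.sub_le n 1))
    ((gradedDegree_polyMinus.pow j).mul gradedDegree_polyPlus n))

theorem coeff_termPoly_succ (m : ℕ) : (termPoly (m + 2) (m + 1)).coeff (m + 2) = 1 := by
  rw [termPoly, coeff_add, coeff_divX, coeff_eq_zero_of_natDegree_lt, zero_add,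
    coeff_polyMinus_pow_mul_polyPlus]
  · have h : ((X + C (-4)) ^ (m + 1) * (X + C 2) : ℂ[X]).Monic :=
      ((monic_X_add_C _).pow _).mul (monic_X_add_C _)
    have h1 := h.coeff_natDegree
    rwa [((monic_X_add_C _).pow _).natDegree_mul (monic_X_add_C _),
      (monic_X_add_C _).natDegree_pow, natDegree_X_add_C, natDegree_X_add_C, mul_one] at h1
  · exact (gradedDegree_polyMinus.pow _ _).trans_lt (Nat.lt_succ_self _)

theorem termPoly_self (n : ℕ) : termPoly n n = ((X + C (-4)) ^ n : ℂ[X]).divX := by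
  rw [termPoly, coeff_polyMinus_pow, coeff_polyMinus_pow_mul_polyPlus_self, add_zero]

theorem natDegree_termPoly_self_le (n : ℕ) : (termPoly (n + 1) (n + 1)).natDegree ≤ n := by
  rw [termPoly_self, natDegree_divX_eq_natDegree_tsub_one, (monic_X_add_C _).natDegree_pow,
    natDegree_X_add_C, mul_one, Nat.add_sub_cancel]

theorem coeff_termPoly_self (n : ℕ) : (termPoly (n + 1) (n + 1)).coeff n = 1 := by
  have h1 := ((monic_X_add_C (-4 : ℂ)).pow (n + 1)).coeff_natDegree
  rwa [(monic_X_add_C _).natDegree_pow, natDegree_X_add_C, mul_one, ← coeff_divX,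
    ← termPoly_self] at h1

theorem natDegree_coeffPolyTerm_le {n j N : ℕ} (h : (termPoly n (j + 1)).natDegree ≤ N) :
    (coeffPolyTerm n j).natDegree ≤ j + N :=
  (natDegree_C_mul_le _ _).trans (natDegree_mul_le.trans (add_le_add
    (natDegree_halfFalling j).le (natDegree_comp_X_add_C_le (natDegree_binomMap_le h) _)))

theorem coeff_coeffPolyTerm {n j N : ℕ} (h : (termPoly n (j + 1)).natDegree ≤ N) :
    (coeffPolyTerm n j).coeff (j + N) = 4 ^ j / (2 * ((j + 1).factorial : ℂ)) *
      ((termPoly n (j + 1)).coeff N * (4 ^ N / (N.factorial : ℂ))) := by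
  rw [coeffPolyTerm, coeff_C_mul, coeff_mul_add_eq_of_natDegree_le (natDegree_halfFalling j).le
    (natDegree_comp_X_add_C_le (natDegree_binomMap_le h) _), coeff_halfFalling, one_mul,
    coeff_comp_X_add_C (natDegree_binomMap_le h), coeff_binomMap h]

theorem natDegree_sum_sinhPoly_le (n : ℕ) :
    (∑ d ∈ n.divisors, sinhPoly d).natDegree ≤ n - 1 :=
  natDegree_sum_le_of_forall_le _ _ fun d hd =>
    (natDegree_sinhPoly_le d).trans (Nat.sub_le_sub_right (Nat.divisor_le hd) 1)

theorem coeffPoly_zero : coeffPoly 0 = 0 := by simp [coeffPoly]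

theorem coeffPoly_one : coeffPoly 1 = 1 := by
  have h0 : binomMap 1 = 1 := by
    have h := binomMap_monomial 0 1
    simpa using h
  have h1 : termPoly 1 1 = 1 := by
    rw [termPoly_self, pow_one, divX_add, divX_C, add_zero, ← pow_one X, divX_X_pow]
    simp
  rw [coeffPoly, Nat.divisors_one, Finset.sum_singleton, sinhPoly, h0, Finset.sum_range_one,
    coeffPolyTerm, zero_add, h1, h0, halfFalling, Finset.range_zero, Finset.prod_empty, one_comp,
    one_comp, mul_one, mul_one, mul_one, ← C_add, ← C_1]
  congr 1
  norm_num

/-- Only the last two summands of `coeffPoly (m + 2)` have degree `2 m + 2`, and their leading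
coefficients are equal. -/
theorem natDegree_coeffPoly_le_and_coeff_ne_zero (m : ℕ) :
    (coeffPoly (m + 2)).natDegree ≤ 2 * m + 2 ∧ (coeffPoly (m + 2)).coeff (2 * m + 2) ≠ 0 := by
  have hA := natDegree_comp_X_add_C_le (natDegree_binomMap_le (natDegree_sum_sinhPoly_le (m + 2))) 1
  have hA1 := (natDegree_C_mul_le (1 / 2 : ℂ) _).trans hA
  have hlow : (∑ j ∈ Finset.range m, coeffPolyTerm (m + 2) j).natDegree ≤ 2 * m + 1 := by
    refine natDegree_sum_le_of_forall_le _ _ fun j hj => ?_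
    have hj1 := Finset.mem_range.mp hj
    exact (natDegree_coeffPolyTerm_le (natDegree_termPoly_le _ _)).trans (by omega)
  have hm := natDegree_coeffPolyTerm_le (natDegree_termPoly_le (m + 2) (m + 1))
  have hm1 := natDegree_coeffPolyTerm_le (natDegree_termPoly_self_le (m + 1))
  have e1 : m + (m + 2) = 2 * m + 2 := by ring
  have e2 : m + 1 + (m + 1) = 2 * m + 2 := by ring
  have cm := coeff_coeffPolyTerm (natDegree_termPoly_le (m + 2) (m + 1))
  have cm1 := coeff_coeffPolyTerm (natDegree_termPoly_self_le (m + 1))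
  rw [coeff_termPoly_succ, e1, one_mul] at cm
  rw [coeff_termPoly_self, e2, one_mul] at cm1
  rw [coeffPoly, Finset.sum_range_succ, Finset.sum_range_succ]
  constructor
  · refine natDegree_add_le_of_degree_le (hA1.trans (by omega)) (natDegree_add_le_of_degree_le
      (natDegree_add_le_of_degree_le (hlow.trans (by omega)) (hm.trans e1.le)) (hm1.trans e2.le))
  · rw [coeff_add, coeff_add, coeff_add, cm, cm1,
      coeff_eq_zero_of_natDegree_lt (hA1.trans_lt (by omega)),
      coeff_eq_zero_of_natDegree_lt (hlow.trans_lt (Nat.lt_succ_self _)), zero_add, zero_add]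
    have h1 : ((m + 1).factorial : ℂ) ≠ 0 := by exact_mod_cast (m + 1).factorial_ne_zero
    have h2 : ((m + 1 + 1).factorial : ℂ) ≠ 0 := by exact_mod_cast (m + 1 + 1).factorial_ne_zero
    have h4 : (4 : ℂ) ^ (2 * m + 2) ≠ 0 := pow_ne_zero _ (by norm_num)
    have h5 : (4 : ℂ) ^ m / (2 * ((m + 1).factorial : ℂ)) *
          (4 ^ (m + 2) / ((m + 2).factorial : ℂ)) +
        4 ^ (m + 1) / (2 * ((m + 1 + 1).factorial : ℂ)) *
          (4 ^ (m + 1) / ((m + 1).factorial : ℂ)) =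
        4 ^ (2 * m + 2) / (((m + 1).factorial : ℂ) * ((m + 1 + 1).factorial : ℂ)) := by
      rw [show m + 2 = m + 1 + 1 by ring] at *
      field_simp
      ring
    rw [h5]
    exact div_ne_zero h4 (mul_ne_zero h1 h2)

theorem degree_coeffPoly {n : ℕ} (hn : 1 ≤ n) :
    (coeffPoly n).degree = ((2 * n - 2 : ℕ) : WithBot ℕ) := by
  obtain rfl | ⟨m, rfl⟩ : n = 1 ∨ ∃ m, n = m + 2 := by
    rcases hn.eq_or_lt with h | h
    · exact Or.inl h.symm
    · exact Or.inr ⟨n - 2, by omega⟩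
  · rw [coeffPoly_one, degree_one]
    rfl
  · obtain ⟨h1, h2⟩ := natDegree_coeffPoly_le_and_coeff_ne_zero m
    rw [show 2 * (m + 2) - 2 = 2 * m + 2 by omega]
    exact degree_eq_of_le_of_coeff_ne_zero (natDegree_le_iff_degree_le.mp h1) h2

end Degree

/-! ### The sequence `B` satisfies the conditions -/

theorem isCharacterized_B : IsCharacterized B where
  quasimodular := isQuasimodular_B
  derivative := hasG2Derivative_B
  polynomial n :=
    ⟨coeffPoly n, fun h => h ▸ coeffPoly_zero, degree_coeffPoly, fun _ hk => coeff_B hk⟩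
  initial := by
    rw [PowerSeries.X_pow_dvd_iff]
    intro n hn
    rw [map_sub, coeff_B (by omega)]
    interval_cases n
    · simp [coeffPoly_zero]
    · simp [coeffPoly_one]

/-! ### Uniqueness -/

theorem prefactor_ne_zero (k : ℕ) :
    (k.factorial : ℂ) / (((2 * k + 1).factorial : ℂ) * (-2 : ℂ) ^ k) ≠ 0 := by
  refine div_ne_zero ?_ (mul_ne_zero ?_ (pow_ne_zero _ (by norm_num)))
  · exact_mod_cast k.factorial_ne_zero
  · exact_mod_cast (2 * k + 1).factorial_ne_zero

/-- If two sequences satisfy the conditions and agree before index `k`, then at index `k` the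
coefficients of `q ^ n` agree for `n ≤ (k + 2) / 3`: the difference of the two polynomials in
condition (b) has degree at most `2 n - 2` and vanishes at `n - 1, …, k - 1`. -/
theorem IsCharacterized.coeff_eq {S T : ℕ → QSeries} (hS : IsCharacterized S)
    (hT : IsCharacterized T) {k n : ℕ} (h : ∀ j < k, S j = T j) (hn : 3 * n ≤ k + 2) :
    PowerSeries.coeff n (S k) = PowerSeries.coeff n (T k) := by
  obtain ⟨Q, hQ0, hQ1, hQ⟩ := hS.polynomial n
  obtain ⟨R, hR0, hR1, hR⟩ := hT.polynomial n
  rw [hQ k (by omega), hR k (by omega)]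
  rcases Nat.eq_zero_or_pos n with rfl | hpos
  · rw [hQ0 rfl, hR0 rfl]
  have hdeg : (Q - R).natDegree ≤ 2 * n - 2 :=
    (Polynomial.natDegree_sub_le _ _).trans (max_le (Polynomial.natDegree_eq_of_degree_eq_some
      (hQ1 hpos)).le (Polynomial.natDegree_eq_of_degree_eq_some (hR1 hpos)).le)
  have hzero : Q - R = 0 := by
    refine Polynomial.eq_zero_of_natDegree_lt_card_of_eval_eq_zero' _
      ((Finset.Ico (n - 1) k).image fun j : ℕ => (j : ℂ)) ?_ ?_
    · intro x hx
      obtain ⟨j, hj, rfl⟩ := Finset.mem_image.mp hx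
      rw [Finset.mem_Ico] at hj
      have h1 := hQ j (by omega)
      rw [h j hj.2, hR j (by omega)] at h1
      rw [Polynomial.eval_sub, mul_left_cancel₀ (prefactor_ne_zero j) h1, sub_self]
    -- There are `k - n + 1` zeros, and `2 n - 2 < k - n + 1` since `3 n ≤ k + 2`.
    · rw [Finset.card_image_of_injective _ Nat.cast_injective, Nat.card_Ico]
      omega
  rw [sub_eq_zero.mp hzero]

/-- The `G₂`-derivatives of `S k` and `T k` agree as soon as `S` and `T` agree before `k`, so their
difference is a modular form of weight `2 k + 4`. -/
theorem IsCharacterized.sub_mem_levelOneSeries {S T : ℕ → QSeries} (hS : IsCharacterized S)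
    (hT : IsCharacterized T) {k : ℕ} (h : ∀ j < k, S j = T j) :
    S k - T k ∈ levelOneSeries (2 * k + 4) := by
  obtain ⟨P, hP, hPS⟩ := hS.quasimodular k
  obtain ⟨R, hR, hRT⟩ := hT.quasimodular k
  have hprev : prev S k = prev T k := by
    cases k with
    | zero => rfl
    | succ k => exact h k (Nat.lt_succ_self k)
  have hd : qExp (MvPolynomial.pderiv 0 (P - R)) = 0 := by
    rw [map_sub, map_sub, (hS.derivative k).2 P hPS, (hT.derivative k).2 R hRT, hprev, sub_self]
  have hPR : MvPolynomial.IsWeightedHomogeneous genWeight (P - R) (2 * k + 4) :=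
    (MvPolynomial.weightedHomogeneousSubmodule ℂ genWeight (2 * k + 4)).sub_mem hP hR
  rw [← hPS, ← hRT, ← map_sub, qExp_eq_aeval_zero hd]
  exact aeval_zero_mem_levelOneSeries hPR

theorem IsCharacterized.unique {S T : ℕ → QSeries} (hS : IsCharacterized S)
    (hT : IsCharacterized T) : S = T := by
  funext k
  induction k using Nat.strong_induction_on with
  | _ k ih =>
    obtain ⟨F, hF⟩ := hS.sub_mem_levelOneSeries hT ih
    have hF0 : F = 0 := by
      refine ModularForm.sturm_bound_levelOne_nat ?_
      rw [hF]
      -- The coefficients agree up to `(k + 2) / 3`, twice the Sturm bound `(2 k + 4) / 12`.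
      refine lt_of_lt_of_le ?_ (PowerSeries.nat_le_order _ ((2 * k + 4) / 12 + 1) fun n hn => ?_)
      · exact_mod_cast Nat.lt_succ_self _
      · rw [map_sub, hS.coeff_eq hT ih (by omega), sub_self]
    rw [hF0, FunLike.coe_zero, UpperHalfPlane.qExpansion_zero] at hF
    exact sub_eq_zero.mp hF.symm

end K3Descendents

end

theorem mainTheorem7 (S : ℕ → K3Descendents.QSeries) :
    K3Descendents.IsCharacterized S ↔ S = K3Descendents.B :=
  ⟨fun h => h.unique K3Descendents.isCharacterized_B,
    fun h => h ▸ K3Descendents.isCharacterized_B⟩
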